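/- Let $\pi$ be a probability measure and $q$ a Markov kernel on a measurable space $\mathsf X$, let $$r(x,y)=\frac{\pi(\mathrm dy)\,q(y,\mathrm dx)}{\pi(\mathrm dx)\,q(x,\mathrm dy)}$$ be (any measurable version of) the Radon--Nikodym derivative of the absolutely continuous part of the numerator with respect to the denominator, and let $$P(x,\mathrm dy)=\min\{1,r(x,y)\}\,q(x,\mathrm dy)+\rho(x)\,\delta_x(\mathrm dy),\qquad \rho(x)=1-\int\min\{1,r(x,y)\}\,q(x,\mathrm dy),$$ be the (marginal) Metropolis--Hastings kernel. Let $\mathsf W\subset\mathbb R_+$ be a Borel set and let $Q_x$ be a Markov kernel from $\mathsf X$ to $\mathsf W$ with $\int w\,Q_x(\mathrm dw)=1$ for all $x$. Put $\tilde\pi(\mathrm dx,\mathrm dw)=\pi(\mathrm dx)\,w\,Q_x(\mathrm dw)$ on $\mathsf X\times\mathsf W$, and let $$\tilde P(x,w;\mathrm dy,\mathrm du)=\min\Big\{1,r(x,y)\frac uw\Big\}\,q(x,\mathrm dy)\,Q_y(\mathrm du)+\tilde\rho(x,w)\,\delta_{x,w}(\mathrm dy,\mathrm du)$$ be the pseudo-marginal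 kernel, $\tilde\rho(x,w)$ being the corresponding rejection probability. For a Markov kernel $\Pi$ reversible with respect to a probability measure $\mu$, and $f$ with $\mu(f^2)<\infty$, let $$\mathrm{var}(f,\Pi)=\lim_{n\to\infty}\frac1n\,\mathbb E\Big(\sum_{k=1}^n\big[f(X_k)-\mu(f)\big]\Big)^2\in[0,\infty],$$ where $(X_k)_{k\ge0}$ is the Markov chain with kernel $\Pi$ and $X_0\sim\mu$, let $\mathrm{var}_\mu(f)=\mu\big((f-\mu(f))^2\big)$, and let $$\mathrm{Gap}(\Pi)=\inf\Big\{\frac{\frac12\int\mu(\mathrm dx)\,\Pi(x,\mathrm dy)\,[f(x)-f(y)]^2}{\mathrm{var}_\mu(f)}\;:\;\mu(f^2)<\infty,\ \mathrm{var}_\mu(f)>0\Big\}\qquad(\inf\emptyset=\infty).$$ For $g:\mathsf X\to\mathbb R$ write $\mathrm{var}(g,\tilde P)=\mathrm{var}(\tilde g,\tilde P)$ with $\tilde g(x,w)=g(x)$. Assume that $\mathrm{Gap}(P)>0$, and let $g:\mathsf X\to\mathbb R$ be measurable with $\pi(g^2)<\infty$. (i) If $\bar w\in[1,\infty)$ is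 such that $Q_x([0,\bar w])=1$ for $\pi$-almost every $x\in\mathsf X$, then the limits that define $\mathrm{var}(g,P)$ and $\mathrm{var}(g,\tilde P)$ exist and $$\mathrm{var}(g,P)\le\mathrm{var}(g,\tilde P)\le\bar w\,\mathrm{var}(g,P)+(\bar w-1)\,\mathrm{var}_\pi(g).$$ (ii) In particular, let $(Q^N)_{N\in\mathbb N}$ be a sequence of such weight kernels, with pseudo-marginal kernels $\tilde P_N$, and let $\bar w_N\to1$ be such that, for all large $N$, $\bar w_N\ge 1$ and $Q^N_x([0,\bar w_N])=1$ for $\pi$-almost every $x$. Then $\lim_{N\to\infty}\mathrm{var}(g,\tilde P_N)=\mathrm{var}(g,P)$. -/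

import Mathlib

open MeasureTheory ProbabilityTheory Filter Topology
open scoped ENNReal NNReal

namespace PseudoMarginal

noncomputable section

section General

variable {E : Type*} [MeasurableSpace E]

/-- The probability `1 - ∫ min {1, r (x, y)} q (x, dy)` that a proposal made from `x` is rejected. -/
def rejectProb (q : Kernel E E) (r : E → E → ℝ≥0∞) (x : E) : ℝ≥0∞ :=
  1 - ∫⁻ y, min 1 (r x y) ∂(q x)

/-- The Metropolis–Hastings kernel with proposal kernel `q` and acceptance ratio `r`:
`P (x, dy) = min {1, r (x, y)} q (x, dy) + δ_x (dy) ρ (x)`, with `ρ` the rejection probability.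
The measurability of `r` is an argument so that this is known to be a Markov kernel. -/
def mhKernel (q : Kernel E E) [IsMarkovKernel q] (r : E → E → ℝ≥0∞)
    (_hr : Measurable (Function.uncurry r)) : Kernel E E :=
  q.withDensity (fun x y ↦ min 1 (r x y)) +
    (Kernel.id : Kernel E E).withDensity (fun x _ ↦ rejectProb q r x)

theorem measurable_min_ratio {r : E → E → ℝ≥0∞} (hr : Measurable (Function.uncurry r)) :
    Measurable (Function.uncurry fun x y ↦ min 1 (r x y)) :=
  measurable_const.min hr

theorem measurable_rejectProb (q : Kernel E E) [IsMarkovKernel q] {r : E → E → ℝ≥0∞}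
    (hr : Measurable (Function.uncurry r)) : Measurable (rejectProb q r) :=
  measurable_const.sub ((measurable_min_ratio hr).lintegral_kernel_prod_right)

theorem mhKernel_apply (q : Kernel E E) [IsMarkovKernel q] (r : E → E → ℝ≥0∞)
    (hr : Measurable (Function.uncurry r)) (x : E) :
    mhKernel q r hr x =
      (q x).withDensity (fun y ↦ min 1 (r x y)) + rejectProb q r x • Measure.dirac x := by
  have h : Measurable (Function.uncurry fun (x : E) (_ : E) ↦ rejectProb q r x) :=
    (measurable_rejectProb q hr).comp measurable_fst
  rw [mhKernel, _root_.add_apply, Kernel.withDensity_apply _ (measurable_min_ratio hr),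
    Kernel.withDensity_apply _ h, Kernel.id_apply, withDensity_const]

instance isMarkovKernel_mhKernel (q : Kernel E E) [IsMarkovKernel q] (r : E → E → ℝ≥0∞)
    (hr : Measurable (Function.uncurry r)) : IsMarkovKernel (mhKernel q r hr) := by
  refine ⟨fun x ↦ ⟨?_⟩⟩
  have hle : ∫⁻ y, min 1 (r x y) ∂(q x) ≤ 1 := by
    calc ∫⁻ y, min 1 (r x y) ∂(q x) ≤ ∫⁻ _, 1 ∂(q x) := lintegral_mono fun y ↦ min_le_left _ _
      _ = 1 := by simp
  rw [mhKernel_apply]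
  simp [rejectProb, add_tsub_cancel_of_le hle]

/-- The law on `ℕ → E` of the Markov chain `X₀, X₁, …` with `X₀ ∼ μ` and transition kernel `Π`. -/
def chainLaw (μ : Measure E) (Pi : Kernel E E) [IsMarkovKernel Pi] : Measure (ℕ → E) :=
  Kernel.trajMeasure (X := fun _ ↦ E) μ
    (fun n ↦ Pi.comap (fun x : (i : Finset.Iic n) → E ↦ x ⟨n, Finset.mem_Iic.2 le_rfl⟩)
      (measurable_pi_apply _))

/-- The quantity `n⁻¹ E (∑_{k=1}^n (f (X_k) - μ (f)))²`, for the chain started from `μ`. -/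
def scaledVar (μ : Measure E) (Pi : Kernel E E) [IsMarkovKernel Pi] (f : E → ℝ) (n : ℕ) : ℝ≥0∞ :=
  (n : ℝ≥0∞)⁻¹ * ∫⁻ ω, ENNReal.ofReal ((∑ k ∈ Finset.Icc 1 n, (f (ω k) - ∫ x, f x ∂μ)) ^ 2)
    ∂(chainLaw μ Pi)

/-- The asymptotic variance `var (f, Π)`, an element of `[0, ∞]`. -/
def asympVar (μ : Measure E) (Pi : Kernel E E) [IsMarkovKernel Pi] (f : E → ℝ) : ℝ≥0∞ :=
  limUnder atTop (scaledVar μ Pi f)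

/-- The Dirichlet form `½ ∫ μ (dx) Π (x, dy) (g (x) - g (y))²`. -/
def dirichletForm (μ : Measure E) (Pi : Kernel E E) (g : E → ℝ) : ℝ≥0∞ :=
  2⁻¹ * ∫⁻ x, ∫⁻ y, ENNReal.ofReal ((g x - g y) ^ 2) ∂(Pi x) ∂μ

/-- The (right) spectral gap: the infimum of `dirichletForm g / var_μ g` over all measurable `g`
with `μ (g²) < ∞` and `var_μ g > 0`; it is `∞` if there is no such `g`. -/
def spectralGap (μ : Measure E) (Pi : Kernel E E) : ℝ≥0∞ :=
  ⨅ (g : E → ℝ) (_ : Measurable g) (_ : MemLp g 2 μ) (_ : 0 < evariance g μ),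
    dirichletForm μ Pi g / evariance g μ

/-- `r` is a version of the Radon–Nikodym derivative
`π (dy) q (y, dx) / (π (dx) q (x, dy))` (it vanishes where the numerator is singular). -/
def IsAcceptanceRatio (π : Measure E) (q : Kernel E E) (r : E → E → ℝ≥0∞) : Prop :=
  Function.uncurry r =ᵐ[π ⊗ₘ q] ((π ⊗ₘ q).map Prod.swap).rnDeriv (π ⊗ₘ q)

end General

section Weights

variable {X : Type*} [MeasurableSpace X] {W : Set ℝ≥0}

/-- The weight `w`, as an extended non-negative real number. -/
def weight (w : W) : ℝ≥0∞ := ((w : ℝ≥0) : ℝ≥0∞)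

theorem measurable_weight : Measurable (weight : W → ℝ≥0∞) :=
  measurable_coe_nnreal_ennreal.comp measurable_subtype_coe

/-- The law `Q_x` of the weight at `x` has mean one, for every `x`. -/
def HasMeanOne (Q : Kernel X W) : Prop := ∀ x, ∫⁻ w, weight w ∂(Q x) = 1

/-- `Q_x ([0, b]) = 1` for `π`-almost every `x`. -/
def WeightsBoundedBy (π : Measure X) (Q : Kernel X W) (b : ℝ) : Prop :=
  ∀ᵐ x ∂π, Q x {w : W | ((w : ℝ≥0) : ℝ) ≤ b} = 1

/-- The target `π̃ (dx, dw) = π (dx) Q_x (dw) w` of the pseudo-marginal algorithm. -/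
def pseudoTarget (π : Measure X) (Q : Kernel X W) [IsMarkovKernel Q] : Measure (X × W) :=
  π ⊗ₘ Q.withDensity (fun _ w ↦ weight w)

/-- The proposal `q̃ (x, w; dy, du) = q (x, dy) Q_y (du)` of the pseudo-marginal algorithm. -/
def pseudoProposal (q : Kernel X X) (Q : Kernel X W) : Kernel (X × W) (X × W) :=
  (q ⊗ₖ Kernel.prodMkLeft X Q).comap Prod.fst measurable_fst

instance (q : Kernel X X) [IsMarkovKernel q] (Q : Kernel X W) [IsMarkovKernel Q] :
    IsMarkovKernel (pseudoProposal q Q) := by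
  unfold pseudoProposal; infer_instance

/-- The acceptance ratio `r (x, y) u / w` of the pseudo-marginal algorithm. The convention for
`w = 0` is immaterial, because `π̃` does not charge `{w = 0}`. -/
def pseudoRatio (r : X → X → ℝ≥0∞) (z z' : X × W) : ℝ≥0∞ :=
  r z.1 z'.1 * (weight z'.2 / weight z.2)

theorem measurable_pseudoRatio {r : X → X → ℝ≥0∞} (hr : Measurable (Function.uncurry r)) :
    Measurable (Function.uncurry (pseudoRatio r : X × W → X × W → ℝ≥0∞)) := by
  have h₁ : Measurable fun p : (X × W) × (X × W) ↦ r p.1.1 p.2.1 :=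
    hr.comp ((measurable_fst.comp measurable_fst).prodMk (measurable_fst.comp measurable_snd))
  have h₂ : Measurable fun p : (X × W) × (X × W) ↦ weight p.2.2 / weight p.1.2 :=
    (measurable_weight.comp (measurable_snd.comp measurable_snd)).div
      (measurable_weight.comp (measurable_snd.comp measurable_fst))
  exact h₁.mul h₂

/-- The pseudo-marginal kernel `P̃`. -/
def pseudoKernel (q : Kernel X X) [IsMarkovKernel q] (r : X → X → ℝ≥0∞)
    (hr : Measurable (Function.uncurry r)) (Q : Kernel X W) [IsMarkovKernel Q] :
    Kernel (X × W) (X × W) :=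
  mhKernel (pseudoProposal q Q) (pseudoRatio r) (measurable_pseudoRatio hr)

instance (q : Kernel X X) [IsMarkovKernel q] (r : X → X → ℝ≥0∞)
    (hr : Measurable (Function.uncurry r)) (Q : Kernel X W) [IsMarkovKernel Q] :
    IsMarkovKernel (pseudoKernel q r hr Q) := by
  unfold pseudoKernel; infer_instance

end Weights

end

end PseudoMarginal

namespace PseudoMarginal

/-! ### Cesàro means of Neumann sums for a self-adjoint contraction. -/

section Hilbert

open scoped InnerProductSpace

variable {H : Type*} [NormedAddCommGroup H] [InnerProductSpace ℝ H]

/-! For a reversible chain with operator `T` on `L²` and a centred `f`, the asymptotic variance is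
`2 S - ‖f‖²`, where `S = sup_h (2 ⟪f, h⟫ - ⟪h, (1 - T) h⟫)` plays the role of `⟪f, (1 - T)⁻¹ f⟫`.
Since `⟪h, (1 - T) h⟫` is the Dirichlet form, comparing asymptotic variances amounts to comparing
Dirichlet forms.

The variational formula, valid whenever `S < ∞`, is proved without the spectral theorem. The
normalised variance of the sum is, up to the term `-‖f‖²`, twice the Cesàro mean of `⟪f, ∑_{k<m} T^k
f⟫` (`norm_sum_chainEval_sq`), and `tendsto_inner_doubleGeomSum` shows that this mean tends to `S`,
using only that products of partial Neumann sums are positive operators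
(`inner_geomSum_geomSum_nonneg`).

With `m = ν + swap ν`, `ν = π ⊗ q`, and `a = dν/dm`, `a' = a ∘ swap`, the two forms become `½ ∫
min(a, a') (h(x) - h(y))² dm` and `½ ∫∫∫ min(a w, a' u) (h(x,w) - h(y,u))² Q_y(du) Q_x(dw) dm`. Both
kernels are therefore reversible. On functions of `x` alone the second form is at most the first,
because the weights have mean one; hence `S ≤ S̃`. Conversely, let `ĥ(x) = ∫ h(x,w) w Q_x(dw)`.
Jensen's inequality and `min(a, a') w u ≤ b min(a w, a' u)` for `w, u ≤ b` bound the form of `ĥ` by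
`b` times that of `h`, while `⟪f, h⟫ = ⟪f, ĥ⟫`; rescaling `ĥ` by `b⁻¹` gives `S̃ ≤ b S`
(`dualForm_pseudo_le`).

The spectral gap of `P` serves only to make `S` finite; `S̃` is then finite by comparison. Finally
`2 b S - v = b (2 S - v) + (b - 1) v`, and part (ii) is a squeeze. -/

/-- The partial Neumann sum `∑_{k < m} T^k`. -/
noncomputable def geomSum (T : H →L[ℝ] H) (m : ℕ) : H →L[ℝ] H := ∑ k ∈ Finset.range m, T ^ k

/-- The sum `∑_{m = 1}^n ∑_{k < m} T^k`. -/
noncomputable def doubleGeomSum (T : H →L[ℝ] H) (n : ℕ) : H →L[ℝ] H :=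
  ∑ m ∈ Finset.range n, geomSum T (m + 1)

section

variable {T : H →L[ℝ] H}

theorem geomSum_add_two (m : ℕ) : geomSum T (m + 2) = 1 + T + T * geomSum T m * T := by
  have h1 : ∀ m, geomSum T (m + 1) = 1 + geomSum T m * T := fun m ↦ by
    simp [geomSum, Finset.sum_range_succ', Finset.sum_mul, pow_succ, add_comm]
  have h2 : ∀ m, geomSum T (m + 1) = 1 + T * geomSum T m := fun m ↦ by
    simp [geomSum, Finset.sum_range_succ', Finset.mul_sum, pow_succ', add_comm]
  rw [h1, h2]; noncomm_ring

theorem sub_geomSum_apply (m : ℕ) (x : H) : geomSum T m x - T (geomSum T m x) = x - (T ^ m) x := by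
  have h := mul_neg_geom_sum T m
  have := congrArg (fun A : H →L[ℝ] H ↦ A x) h
  simpa [geomSum, sub_mul] using this

theorem geomSum_sub_apply (m : ℕ) (x : H) : geomSum T m (x - T x) = x - (T ^ m) x := by
  have h := geom_sum_mul_neg T m
  have := congrArg (fun A : H →L[ℝ] H ↦ A x) h
  simpa [geomSum, mul_sub] using this

theorem geomSum_succ_apply (m : ℕ) (x : H) : geomSum T (m + 1) x = x + T (geomSum T m x) := by
  simp [geomSum, Finset.sum_range_succ', pow_succ', add_comm]

theorem sum_pow_succ_apply (n : ℕ) (x : H) :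
    ∑ m ∈ Finset.range n, (T ^ (m + 1)) x = T (geomSum T n x) := by
  simp [geomSum, pow_succ']

theorem sub_doubleGeomSum_apply (n : ℕ) (x : H) :
    doubleGeomSum T n x - T (doubleGeomSum T n x) = (n : ℝ) • x - T (geomSum T n x) := by
  simp only [doubleGeomSum, sum_apply, map_sum, ← Finset.sum_sub_distrib,
    sub_geomSum_apply]
  rw [Finset.sum_sub_distrib, sum_pow_succ_apply]
  simp [Nat.cast_smul_eq_nsmul]

theorem doubleGeomSum_sub_apply (n : ℕ) (x : H) :
    doubleGeomSum T n (x - T x) = (n : ℝ) • x - T (geomSum T n x) := by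
  simp only [doubleGeomSum, sum_apply, geomSum_sub_apply]
  rw [Finset.sum_sub_distrib, sum_pow_succ_apply]
  simp [Nat.cast_smul_eq_nsmul]

theorem norm_pow_apply_le (hT : ∀ x, ‖T x‖ ≤ ‖x‖) (n : ℕ) (x : H) : ‖(T ^ n) x‖ ≤ ‖x‖ := by
  induction n with
  | zero => simp
  | succ n ih => rw [pow_succ']; exact (hT _).trans ih

theorem inner_geomSum_comm (hs : ∀ x y, ⟪x, T y⟫_ℝ = ⟪T x, y⟫_ℝ)
    (m : ℕ) (x y : H) : ⟪x, geomSum T m y⟫_ℝ = ⟪geomSum T m x, y⟫_ℝ := by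
  have hp : ∀ k : ℕ, ∀ x y, ⟪x, (T ^ k) y⟫_ℝ = ⟪(T ^ k) x, y⟫_ℝ := by
    intro k
    induction k with
    | zero => simp
    | succ k ih =>
      intro x y
      rw [pow_succ', mul_apply_eq_comp, hs, ih, ← mul_apply_eq_comp,
        ← pow_succ, pow_succ']
  simp only [geomSum, sum_apply, inner_sum, sum_inner, hp]

theorem inner_doubleGeomSum_comm (hs : ∀ x y, ⟪x, T y⟫_ℝ = ⟪T x, y⟫_ℝ)
    (m : ℕ) (x y : H) :
    ⟪x, doubleGeomSum T m y⟫_ℝ = ⟪doubleGeomSum T m x, y⟫_ℝ := by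
  simp [doubleGeomSum, inner_sum, sum_inner, inner_geomSum_comm hs]

theorem inner_add_self_nonneg (hT : ∀ x, ‖T x‖ ≤ ‖x‖)
    (x : H) : 0 ≤ ⟪x, x + T x⟫_ℝ := by
  have h1 := abs_le.1 (abs_real_inner_le_norm x (T x))
  have h2 : ‖x‖ * ‖T x‖ ≤ ‖x‖ * ‖x‖ := mul_le_mul_of_nonneg_left (hT x) (norm_nonneg x)
  rw [inner_add_right, real_inner_self_eq_norm_mul_norm]
  linarith [h1.1]

theorem inner_add_geomSum_nonneg (hs : ∀ x y, ⟪x, T y⟫_ℝ = ⟪T x, y⟫_ℝ)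
    (hT : ∀ x, ‖T x‖ ≤ ‖x‖)
    (j : ℕ) : ∀ x : H, 0 ≤ ⟪x + T x, geomSum T j x⟫_ℝ := by
  induction j using Nat.twoStepInduction with
  | zero => simp [geomSum]
  | one => intro x; rw [real_inner_comm]; simpa [geomSum] using inner_add_self_nonneg hT x
  | more j ih _ =>
    intro x
    have h := ih (T x)
    rw [geomSum_add_two]
    have e : (1 + T + T * geomSum T j * T) x = (x + T x) + T (geomSum T j (T x)) := by simp
    rw [e, inner_add_right, hs, map_add]
    exact add_nonneg real_inner_self_nonneg h

/-- Spectrally, `(1 - t^i) / (1 - t) ≥ 0` on `[-1, 1]`. The recursion `G_{m+2} = (1 + T) + T G_m T`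
replaces functional calculus: `1 + T` is positive and conjugation by `T` preserves positivity, so
the induction goes in steps of two. -/
theorem inner_geomSum_geomSum_nonneg (hs : ∀ x y, ⟪x, T y⟫_ℝ = ⟪T x, y⟫_ℝ)
    (hT : ∀ x, ‖T x‖ ≤ ‖x‖)
    (i j : ℕ) :
    ∀ x : H, 0 ≤ ⟪geomSum T i x, geomSum T j x⟫_ℝ := by
  induction i using Nat.twoStepInduction with
  | zero => simp [geomSum]
  | one =>
    intro x
    rw [show geomSum T 1 x = x by simp [geomSum]]
    induction j using Nat.twoStepInduction generalizing x with
    | zero => simp [geomSum]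
    | one => simp [geomSum]
    | more j ih _ =>
      have h := ih (T x)
      rw [geomSum_add_two]
      have e : (1 + T + T * geomSum T j * T) x = (x + T x) + T (geomSum T j (T x)) := by simp
      rw [e, inner_add_right, hs]
      exact add_nonneg (inner_add_self_nonneg hT x) h
  | more i ih _ =>
    intro x
    have h := ih (T x)
    have h' := inner_add_geomSum_nonneg hs hT j x
    have e : geomSum T (i + 2) x = (x + T x) + T (geomSum T i (T x)) := by
      rw [geomSum_add_two]; simp
    -- Both `(1 - T) G_j x` and `G_j (1 - T) x` equal `x - T^j x`, so `T` and `G_j` commute.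
    have e2 : T (geomSum T j x) = geomSum T j (T x) := by
      have := sub_geomSum_apply (T := T) j x
      have h2 := geomSum_sub_apply (T := T) j x
      rw [map_sub, ← this] at h2
      exact (sub_right_injective h2).symm
    rw [e, inner_add_left, ← hs, e2]
    exact add_nonneg h' h

theorem inner_doubleGeomSum_nonneg (hs : ∀ x y, ⟪x, T y⟫_ℝ = ⟪T x, y⟫_ℝ)
    (hT : ∀ x, ‖T x‖ ≤ ‖x‖)
    (n : ℕ) (x : H) : 0 ≤ ⟪x, doubleGeomSum T n x⟫_ℝ := by
  simp only [doubleGeomSum, sum_apply, inner_sum]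
  refine Finset.sum_nonneg fun m _ ↦ ?_
  simpa [geomSum] using inner_geomSum_geomSum_nonneg hs hT 1 (m + 1) x

theorem inner_sub_self_nonneg (hT : ∀ x, ‖T x‖ ≤ ‖x‖)
    (x : H) : 0 ≤ ⟪x, x - T x⟫_ℝ := by
  have h1 := abs_le.1 (abs_real_inner_le_norm x (T x))
  have h2 : ‖x‖ * ‖T x‖ ≤ ‖x‖ * ‖x‖ := mul_le_mul_of_nonneg_left (hT x) (norm_nonneg x)
  rw [inner_sub_right, real_inner_self_eq_norm_mul_norm]
  linarith [h1.2]

variable {f : H} {S : ℝ}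

/-- Testing the bound on every multiple `t • h` gives a quadratic in `t` that is nonnegative; its
discriminant is then nonpositive. -/
theorem sq_inner_le_of_forall_le (hS : ∀ h, 2 * ⟪f, h⟫_ℝ - ⟪h, h - T h⟫_ℝ ≤ S) (h : H) :
    ⟪f, h⟫_ℝ ^ 2 ≤ S * ⟪h, h - T h⟫_ℝ := by
  have key : ∀ t : ℝ, 0 ≤ ⟪h, h - T h⟫_ℝ * (t * t) + (-2 * ⟪f, h⟫_ℝ) * t + S := by
    intro t
    have := hS (t • h)
    rw [map_smul, ← smul_sub, inner_smul_right, inner_smul_right, real_inner_smul_left] at this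
    linarith
  have := discrim_le_zero key
  rw [discrim] at this
  linarith

/-- The test vector is `D f`, with `D = doubleGeomSum T n` and `(1 - T) D f = n f - T G_n f`. For `x
= ⟪f, D f⟫` this yields `x² ≤ S (n x - ⟪D f, T G_n f⟫)`, and positivity of `⟪D f, G_{n+1} f⟫` bounds
the last term by `x`. Hence `x² ≤ S (n + 1) x`. -/
theorem inner_doubleGeomSum_le (hs : ∀ x y, ⟪x, T y⟫_ℝ = ⟪T x, y⟫_ℝ)
    (hT : ∀ x, ‖T x‖ ≤ ‖x‖)
    (hS : ∀ h, 2 * ⟪f, h⟫_ℝ - ⟪h, h - T h⟫_ℝ ≤ S) (n : ℕ) :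
    ⟪f, doubleGeomSum T n f⟫_ℝ ≤ S * (n + 1) := by
  have hS0 : 0 ≤ S := by simpa using hS 0
  set x := ⟪f, doubleGeomSum T n f⟫_ℝ with hx
  have h1 := sq_inner_le_of_forall_le hS (doubleGeomSum T n f)
  rw [sub_doubleGeomSum_apply, ← hx] at h1
  have h2 : 0 ≤ ⟪doubleGeomSum T n f, geomSum T (n + 1) f⟫_ℝ := by
    simp only [doubleGeomSum, sum_apply, sum_inner]
    exact Finset.sum_nonneg fun m _ ↦ inner_geomSum_geomSum_nonneg hs hT _ _ _
  rw [geomSum_succ_apply, inner_add_right] at h2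
  rw [inner_sub_right, inner_smul_right] at h1
  rw [real_inner_comm] at hx
  rw [← hx] at h1 h2
  have h3 : x ^ 2 ≤ S * (n + 1) * x := by nlinarith
  rcases (inner_doubleGeomSum_nonneg hs hT n f).lt_or_eq with h0 | h0
  · rw [real_inner_comm, ← hx] at h0
    exact le_of_mul_le_mul_right (by linarith) h0
  · rw [real_inner_comm, ← hx] at h0
    rw [← h0]; positivity

/-- Expand the positivity of `D = doubleGeomSum T n` at `f - (1 - T) h`, using `D (1 - T) h = n h -
c` with `c = T G_n h`. The terms in `c` are errors of order `√n` and `1`, negligible after division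
by `n`. -/
theorem le_inner_doubleGeomSum (hs : ∀ x y, ⟪x, T y⟫_ℝ = ⟪T x, y⟫_ℝ)
    (hT : ∀ x, ‖T x‖ ≤ ‖x‖)
    (hS : ∀ h, 2 * ⟪f, h⟫_ℝ - ⟪h, h - T h⟫_ℝ ≤ S) (n : ℕ) (h : H) :
    n * (2 * ⟪f, h⟫_ℝ - ⟪h, h - T h⟫_ℝ) - 2 * √(2 * n * S) * ‖h‖ - 2 * ‖h‖ ^ 2 ≤
      ⟪f, doubleGeomSum T n f⟫_ℝ := by
  have hS0 : 0 ≤ S := by simpa using hS 0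
  set c := T (geomSum T n h) with hc
  have hcT : c - T c = T h - (T ^ (n + 1)) h := by
    rw [hc, ← map_sub, sub_geomSum_apply, map_sub, pow_succ', mul_apply_eq_comp]
  have hn : ‖c - T c‖ ≤ 2 * ‖h‖ := by
    rw [hcT]
    linarith [norm_sub_le (T h) ((T ^ (n + 1)) h), hT h, norm_pow_apply_le hT (n + 1) h]
  have hcn : ‖c‖ ≤ n * ‖h‖ := by
    rw [hc, ← sum_pow_succ_apply]
    refine (norm_sum_le_of_le _ fun m _ ↦ norm_pow_apply_le hT (m + 1) h).trans ?_
    simp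
  -- Although `‖c‖` may grow like `n`, `(1 - T) c` telescopes and stays bounded, so `⟪c, (1 - T) c⟫`
  -- is only of order `n` and `⟪f, c⟫` of order `√n`.
  have hfc : ⟪f, c⟫_ℝ ≤ √(2 * n * S) * ‖h‖ := by
    have h1 := sq_inner_le_of_forall_le hS c
    have h2 : ⟪c, c - T c⟫_ℝ ≤ n * ‖h‖ * (2 * ‖h‖) :=
      (real_inner_le_norm _ _).trans (mul_le_mul hcn hn (norm_nonneg _) (by positivity))
    refine abs_le_of_sq_le_sq' ?_ (by positivity) |>.2
    rw [mul_pow, Real.sq_sqrt (by positivity)]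
    nlinarith
  have hhc : ⟪h - T h, c⟫_ℝ ≥ -(2 * ‖h‖ ^ 2) := by
    have : ⟪h - T h, c⟫_ℝ = ⟪h, c - T c⟫_ℝ := by
      rw [inner_sub_left, inner_sub_right, hs h c]
    rw [this]
    have h1 := (abs_le.1 (abs_real_inner_le_norm h (c - T c))).1
    nlinarith [norm_nonneg h]
  have hk := inner_doubleGeomSum_nonneg hs hT n (f - (h - T h))
  rw [map_sub, inner_sub_left, inner_sub_right, inner_sub_right, doubleGeomSum_sub_apply,
    inner_doubleGeomSum_comm hs n (h - T h) f, doubleGeomSum_sub_apply, ← hc] at hk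
  simp only [inner_sub_left, inner_sub_right, real_inner_smul_left, inner_smul_right] at hk hhc ⊢
  rw [real_inner_comm f h, real_inner_comm f c, real_inner_comm h (T h)] at hk
  linarith

/-- The Cesàro means of `⟪f, ∑_{k < m} T^k f⟫` converge to the value of the variational problem
that defines `⟪f, (1 - T)⁻¹ f⟫`. -/
theorem tendsto_inner_doubleGeomSum (hs : ∀ x y, ⟪x, T y⟫_ℝ = ⟪T x, y⟫_ℝ)
    (hT : ∀ x, ‖T x‖ ≤ ‖x‖)
   
    (hS : IsLUB (Set.range fun h ↦ 2 * ⟪f, h⟫_ℝ - ⟪h, h - T h⟫_ℝ) S) :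
    Tendsto (fun n : ℕ ↦ (n : ℝ)⁻¹ * ⟪f, doubleGeomSum T n f⟫_ℝ) atTop (𝓝 S) := by
  have hS' : ∀ h, 2 * ⟪f, h⟫_ℝ - ⟪h, h - T h⟫_ℝ ≤ S := fun h ↦ hS.1 ⟨h, rfl⟩
  have hS0 : 0 ≤ S := by simpa using hS' 0
  have hinv : Tendsto (fun n : ℕ ↦ (n : ℝ)⁻¹) atTop (𝓝 0) := tendsto_inv_atTop_nhds_zero_nat
  refine tendsto_order.2 ⟨fun a ha ↦ ?_, fun a ha ↦ ?_⟩
  · obtain ⟨_, ⟨h, rfl⟩, hh⟩ := (lt_isLUB_iff hS).1 ha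
    have h1 : Tendsto (fun n : ℕ ↦ (2 * ⟪f, h⟫_ℝ - ⟪h, h - T h⟫_ℝ) -
        2 * √(2 * S * (n : ℝ)⁻¹) * ‖h‖ - (n : ℝ)⁻¹ * (2 * ‖h‖ ^ 2)) atTop
        (𝓝 ((2 * ⟪f, h⟫_ℝ - ⟪h, h - T h⟫_ℝ) - 2 * √(2 * S * 0) * ‖h‖ - 0 * (2 * ‖h‖ ^ 2))) :=
      (tendsto_const_nhds.sub
        (((hinv.const_mul _).sqrt.const_mul _).mul_const _)).sub (hinv.mul_const _)
    simp only [mul_zero, Real.sqrt_zero, zero_mul, sub_zero] at h1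
    filter_upwards [(tendsto_order.1 h1).1 a hh, eventually_gt_atTop 0] with n hn hn0
    refine hn.trans_le ?_
    have hn' : (0 : ℝ) < n := by exact_mod_cast hn0
    have h2 := le_inner_doubleGeomSum hs hT hS' n h
    have h3 : √(2 * S * (n : ℝ)⁻¹) = (n : ℝ)⁻¹ * √(2 * n * S) := by
      rw [show 2 * S * (n : ℝ)⁻¹ = ((n : ℝ)⁻¹) ^ 2 * (2 * n * S) by field_simp,
        Real.sqrt_mul (by positivity), Real.sqrt_sq (by positivity)]
    have h4 := mul_le_mul_of_nonneg_left h2 (inv_nonneg.2 hn'.le)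
    rw [h3]
    refine le_trans (le_of_eq ?_) h4
    field_simp
  · have h1 : Tendsto (fun n : ℕ ↦ S * (1 + (n : ℝ)⁻¹)) atTop (𝓝 (S * (1 + 0))) :=
      (tendsto_const_nhds.add hinv).const_mul _
    rw [add_zero, mul_one] at h1
    filter_upwards [(tendsto_order.1 h1).2 a ha, eventually_gt_atTop 0] with n hn hn0
    refine lt_of_le_of_lt ?_ hn
    have hn' : (0 : ℝ) < n := by exact_mod_cast hn0
    have h2 := mul_le_mul_of_nonneg_left (inner_doubleGeomSum_le hs hT hS' n) (inv_nonneg.2 hn'.le)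
    refine h2.trans (le_of_eq ?_)
    field_simp

end

end Hilbert

/-! ### The `L²` operator of a reversible kernel and its Dirichlet form. -/

section KernelOperator

open scoped InnerProductSpace

variable {E : Type*} [MeasurableSpace E]

theorem ofReal_norm_sq_eq_lintegral {μ : Measure E} (F : Lp ℝ 2 μ) :
    ENNReal.ofReal (‖F‖ ^ 2) = ∫⁻ x, ENNReal.ofReal (F x ^ 2) ∂μ := by
  rw [← ofReal_integral_eq_lintegral_ofReal (Lp.memLp F).integrable_sq
    (Eventually.of_forall fun x ↦ sq_nonneg _), ← real_inner_self_eq_norm_sq, L2.inner_def]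
  simp [pow_two]

theorem inner_toLp_toLp {μ : Measure E} {f g : E → ℝ} (hf : MemLp f 2 μ) (hg : MemLp g 2 μ) :
    ⟪hf.toLp f, hg.toLp g⟫_ℝ = ∫ x, f x * g x ∂μ := by
  rw [L2.inner_def]
  refine integral_congr_ae ?_
  filter_upwards [hf.coeFn_toLp, hg.coeFn_toLp] with x h1 h2
  simp [h1, h2, mul_comm]

theorem inner_compMeasurePreserving {Ω : Type*} [MeasurableSpace Ω] {P : Measure Ω}
    {μ : Measure E} {X Y : Ω → E} (hX : MeasurePreserving X P μ) (hY : MeasurePreserving Y P μ)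
    (φ ψ : Lp ℝ 2 μ) :
    ⟪Lp.compMeasurePreserving X hX φ, Lp.compMeasurePreserving Y hY ψ⟫_ℝ =
      ∫ ω, φ (X ω) * ψ (Y ω) ∂P := by
  rw [L2.inner_def]
  refine integral_congr_ae ?_
  filter_upwards [Lp.coeFn_compMeasurePreserving φ hX, Lp.coeFn_compMeasurePreserving ψ hY]
    with x h1 h2
  rw [h1, h2]
  exact mul_comm _ _

theorem integrable_integral_compProd {F : Type*} [MeasurableSpace F] {μ : Measure E} [SFinite μ]
    {κ : Kernel E F} [IsSFiniteKernel κ] {f : E × F → ℝ} (hf : Integrable f (μ ⊗ₘ κ)) :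
    Integrable (fun x ↦ ∫ y, f (x, y) ∂(κ x)) μ := by
  rw [Measure.compProd] at hf
  simpa using hf.integral_compProd

variable (μ : Measure E) [IsProbabilityMeasure μ] (K : Kernel E E) [IsMarkovKernel K]

theorem measurePreserving_fst_compProd : MeasurePreserving Prod.fst (μ ⊗ₘ K) μ :=
  ⟨measurable_fst, Measure.fst_compProd μ K⟩

variable {μ K}

theorem measurePreserving_snd_compProd (hrev : (μ ⊗ₘ K).map Prod.swap = μ ⊗ₘ K) :
    MeasurePreserving Prod.snd (μ ⊗ₘ K) μ := by
  refine ⟨measurable_snd, ?_⟩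
  rw [← hrev, Measure.map_map measurable_snd measurable_swap]
  exact Measure.fst_compProd μ K

/-- The operator `h ↦ ∫ h (y) Π (·, dy)` of a reversible kernel on `L²`. -/
noncomputable def kernelOp (hrev : (μ ⊗ₘ K).map Prod.swap = μ ⊗ₘ K) :
    Lp ℝ 2 μ →L[ℝ] Lp ℝ 2 μ :=
  (ContinuousLinearMap.adjoint (Lp.compMeasurePreservingₗᵢ ℝ Prod.fst
    (measurePreserving_fst_compProd μ K) :
      Lp ℝ 2 μ →ₗᵢ[ℝ] Lp ℝ 2 (μ ⊗ₘ K)).toContinuousLinearMap) ∘L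
  (Lp.compMeasurePreservingₗᵢ ℝ Prod.snd (measurePreserving_snd_compProd hrev) :
      Lp ℝ 2 μ →ₗᵢ[ℝ] Lp ℝ 2 (μ ⊗ₘ K)).toContinuousLinearMap

variable (hrev : (μ ⊗ₘ K).map Prod.swap = μ ⊗ₘ K)

theorem inner_kernelOp_eq_inner (h k : Lp ℝ 2 μ) :
    ⟪h, kernelOp hrev k⟫_ℝ =
      ⟪Lp.compMeasurePreserving Prod.fst (measurePreserving_fst_compProd μ K) h,
        Lp.compMeasurePreserving Prod.snd (measurePreserving_snd_compProd hrev) k⟫_ℝ := by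
  rw [kernelOp, ContinuousLinearMap.comp_apply, ContinuousLinearMap.adjoint_inner_right]
  rfl

theorem inner_kernelOp (h k : Lp ℝ 2 μ) :
    ⟪h, kernelOp hrev k⟫_ℝ = ∫ z, h z.1 * k z.2 ∂(μ ⊗ₘ K) := by
  rw [inner_kernelOp_eq_inner, inner_compMeasurePreserving]

theorem inner_kernelOp_comm (h k : Lp ℝ 2 μ) :
    ⟪h, kernelOp hrev k⟫_ℝ = ⟪kernelOp hrev h, k⟫_ℝ := by
  rw [real_inner_comm k, inner_kernelOp, inner_kernelOp]
  have hsw : MeasurePreserving Prod.swap (μ ⊗ₘ K) (μ ⊗ₘ K) := ⟨measurable_swap, hrev⟩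
  rw [← hsw.integral_comp (MeasurableEquiv.prodComm.measurableEmbedding)]
  exact integral_congr_ae (Eventually.of_forall fun z ↦ mul_comm _ _)

theorem norm_kernelOp_apply_le (h : Lp ℝ 2 μ) : ‖kernelOp hrev h‖ ≤ ‖h‖ := by
  have h1 : ‖kernelOp hrev h‖ * ‖kernelOp hrev h‖ ≤ ‖kernelOp hrev h‖ * ‖h‖ := by
    rw [← real_inner_self_eq_norm_mul_norm, inner_kernelOp_eq_inner]
    refine (real_inner_le_norm _ _).trans ?_
    rw [Lp.norm_compMeasurePreserving, Lp.norm_compMeasurePreserving]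
  rcases (norm_nonneg (kernelOp hrev h)).eq_or_lt with h0 | h0
  · rw [← h0]; exact norm_nonneg h
  · exact le_of_mul_le_mul_left h1 h0

/-- The adjoint definition is matched with the pointwise one by integrating both over every
measurable set, that is, pairing with indicators. -/
theorem kernelOp_ae_eq (k : Lp ℝ 2 μ) : kernelOp hrev k =ᵐ[μ] fun x ↦ ∫ y, k y ∂(K x) := by
  have hk : Integrable (fun z : E × E ↦ k z.2) (μ ⊗ₘ K) :=
    ((Lp.memLp k).comp_measurePreserving (measurePreserving_snd_compProd hrev)).integrable
      one_le_two
  refine Integrable.ae_eq_of_forall_setIntegral_eq _ _ ((Lp.memLp _).integrable one_le_two)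
    (integrable_integral_compProd hk) fun s hs _ ↦ ?_
  have h1 := L2.inner_indicatorConstLp_one (𝕜 := ℝ) hs (measure_ne_top μ s) (kernelOp hrev k)
  rw [← h1, inner_kernelOp]
  have h2 : (fun z : E × E ↦ (indicatorConstLp 2 hs (measure_ne_top μ s) (1 : ℝ) : E → ℝ) z.1 *
      k z.2) =ᵐ[μ ⊗ₘ K] (s ×ˢ Set.univ).indicator fun z ↦ k z.2 := by
    have h3 := (measurePreserving_fst_compProd μ K).quasiMeasurePreserving.ae
      (indicatorConstLp_coeFn (p := 2) (hs := hs) (hμs := measure_ne_top μ s) (c := (1 : ℝ)))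
    filter_upwards [h3] with z hz
    rw [hz]
    by_cases hzs : z.1 ∈ s <;> simp [hzs]
  rw [integral_congr_ae h2, integral_indicator (hs.prod MeasurableSet.univ),
    Measure.setIntegral_compProd hs MeasurableSet.univ hk.integrableOn]
  simp

theorem dirichletForm_eq_lintegral_compProd {h : E → ℝ} (hh : Measurable h) :
    dirichletForm μ K h =
      2⁻¹ * ∫⁻ z, ENNReal.ofReal ((h z.1 - h z.2) ^ 2) ∂(μ ⊗ₘ K) := by
  rw [dirichletForm, Measure.lintegral_compProd (by fun_prop)]

theorem dirichletForm_eq_ofReal_inner {h : E → ℝ} (hh : Measurable h) (h2 : MemLp h 2 μ) :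
    dirichletForm μ K h =
      ENNReal.ofReal ⟪h2.toLp h, h2.toLp h - kernelOp hrev (h2.toLp h)⟫_ℝ := by
  set H := h2.toLp h
  set A := Lp.compMeasurePreserving Prod.fst (measurePreserving_fst_compProd μ K) H with hA
  set B := Lp.compMeasurePreserving Prod.snd (measurePreserving_snd_compProd hrev) H with hB
  -- Stationarity gives `‖A‖ = ‖B‖ = ‖H‖`, so `‖A - B‖² = 2 ‖H‖² - 2 ⟪A, B⟫`.
  have h3 : ⟪H, H - kernelOp hrev H⟫_ℝ = 2⁻¹ * ‖A - B‖ ^ 2 := by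
    have hnA : ‖A‖ = ‖H‖ := Lp.norm_compMeasurePreserving _ _
    have hnB : ‖B‖ = ‖H‖ := Lp.norm_compMeasurePreserving _ _
    rw [inner_sub_right, inner_kernelOp_eq_inner, ← hA, ← hB, norm_sub_sq_real, hnA, hnB,
      real_inner_self_eq_norm_sq]
    ring
  rw [dirichletForm_eq_lintegral_compProd hh, h3, ENNReal.ofReal_mul (by norm_num),
    ofReal_norm_sq_eq_lintegral, ENNReal.ofReal_inv_of_pos two_pos, ENNReal.ofReal_ofNat]
  congr 1
  refine lintegral_congr_ae ?_
  have e1 := (measurePreserving_fst_compProd μ K).quasiMeasurePreserving.ae h2.coeFn_toLp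
  have e2 := (measurePreserving_snd_compProd hrev).quasiMeasurePreserving.ae h2.coeFn_toLp
  filter_upwards [Lp.coeFn_sub A B, Lp.coeFn_compMeasurePreserving H
    (measurePreserving_fst_compProd μ K), Lp.coeFn_compMeasurePreserving H
    (measurePreserving_snd_compProd hrev), e1, e2] with z h4 h5 h6 h7 h8
  rw [h4, Pi.sub_apply, hA, hB, h5, h6, Function.comp_apply, Function.comp_apply, h7, h8]

end KernelOperator

/-! ### Covariances and partial sums of the stationary chain. -/

section Chain

open scoped InnerProductSpace

variable {E : Type*} [MeasurableSpace E]

theorem chainLaw_map_zero (μ : Measure E) (K : Kernel E E) [IsMarkovKernel K] : (chainLaw μ K).map (fun ω ↦ ω 0) = μ := by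
  have h : (fun ω : ℕ → E ↦ ω 0) = (fun x : (i : Finset.Iic 0) → E ↦ x ⟨0, by simp⟩) ∘
    Preorder.frestrictLe (π := fun _ ↦ E) 0 := rfl
  rw [h, ← Measure.map_map (measurable_pi_apply _) (by fun_prop), chainLaw, Kernel.trajMeasure,
    Measure.map_comp _ _ (by fun_prop), Kernel.traj_map_frestrictLe, Kernel.partialTraj_self,
    Measure.id_comp, Measure.map_map (measurable_pi_apply _) (by fun_prop)]
  exact Measure.map_id

variable {μ : Measure E} [IsProbabilityMeasure μ] {K : Kernel E E} [IsMarkovKernel K]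

instance : IsProbabilityMeasure (chainLaw μ K) := by unfold chainLaw; infer_instance

variable (μ K) in
theorem chainLaw_map_succ (n : ℕ) :
    ((chainLaw μ K).map (Preorder.frestrictLe (π := fun _ ↦ E) n)) ⊗ₘ
      (K.comap (fun x : (i : Finset.Iic n) → E ↦ x ⟨n, Finset.mem_Iic.2 le_rfl⟩)
        (measurable_pi_apply _)) =
    (chainLaw μ K).map (fun ω ↦ (Preorder.frestrictLe n ω, ω (n + 1))) :=
  Kernel.map_frestrictLe_trajMeasure_compProd_eq_map_trajMeasure

theorem measurePreserving_chainLaw (hrev : (μ ⊗ₘ K).map Prod.swap = μ ⊗ₘ K) (n : ℕ) :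
    MeasurePreserving (fun ω ↦ ω n) (chainLaw μ K) μ := by
  induction n with
  | zero => exact ⟨measurable_pi_apply _, chainLaw_map_zero μ K⟩
  | succ n ih =>
    refine ⟨measurable_pi_apply _, ?_⟩
    have h := congrArg (Measure.map Prod.snd) (chainLaw_map_succ μ K n)
    rw [Measure.map_map measurable_snd (by fun_prop)] at h
    refine Eq.trans h.symm ?_
    ext s hs
    rw [Measure.map_apply measurable_snd hs, Measure.compProd_apply (measurable_snd hs),
      lintegral_map (Kernel.measurable_kernel_prodMk_left (measurable_snd hs)) (by fun_prop)]
    have h2 : (μ ⊗ₘ K).map Prod.snd s = μ s := by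
      rw [(measurePreserving_snd_compProd hrev).map_eq]
    rw [← h2, Measure.map_apply measurable_snd hs, Measure.compProd_apply (measurable_snd hs),
      ← ih.lintegral_comp (Kernel.measurable_kernel_prodMk_left (measurable_snd hs))]
    rfl

/-- The value at time `n` of the stationary chain, as an operator `L² (μ) → L² (chainLaw)`. -/
noncomputable def chainEval (hrev : (μ ⊗ₘ K).map Prod.swap = μ ⊗ₘ K) (n : ℕ) :
    Lp ℝ 2 μ →+ Lp ℝ 2 (chainLaw μ K) :=
  Lp.compMeasurePreserving (fun ω ↦ ω n) (measurePreserving_chainLaw hrev n)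

variable (hrev : (μ ⊗ₘ K).map Prod.swap = μ ⊗ₘ K)

theorem norm_chainEval (n : ℕ) (φ : Lp ℝ 2 μ) : ‖chainEval hrev n φ‖ = ‖φ‖ :=
  Lp.norm_compMeasurePreserving _ _

/-- The Markov property: given the path up to time `n`, the conditional mean of `ψ (X_{n+1})` is `(T
ψ) (X_n)`, and `φ (X_i)` is a function of that path. -/
theorem inner_chainEval_succ {i n : ℕ} (hin : i ≤ n) (φ ψ : Lp ℝ 2 μ) :
    ⟪chainEval hrev i φ, chainEval hrev (n + 1) ψ⟫_ℝ =
      ⟪chainEval hrev i φ, chainEval hrev n (kernelOp hrev ψ)⟫_ℝ := by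
  rw [chainEval, chainEval, chainEval, inner_compMeasurePreserving, inner_compMeasurePreserving]
  have hφ := (Lp.stronglyMeasurable φ).measurable
  have hψ := (Lp.stronglyMeasurable ψ).measurable
  have hi : i ∈ Finset.Iic n := Finset.mem_Iic.2 hin
  have hint : Integrable (fun ω ↦ φ (ω i) * ψ (ω (n + 1))) (chainLaw μ K) :=
    ((Lp.memLp φ).comp_measurePreserving (measurePreserving_chainLaw hrev i)).integrable_mul
      ((Lp.memLp ψ).comp_measurePreserving (measurePreserving_chainLaw hrev (n + 1)))
  let g : ((i : Finset.Iic n) → E) × E → ℝ := fun p ↦ φ (p.1 ⟨i, hi⟩) * ψ p.2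
  have hg : Measurable g := by
    refine (hφ.comp ((measurable_pi_apply _).comp measurable_fst)).mul (hψ.comp measurable_snd)
  have hm : Measurable fun ω : ℕ → E ↦ (Preorder.frestrictLe (π := fun _ ↦ E) n ω, ω (n + 1)) := by
    fun_prop
  have h1 : ∫ ω, φ (ω i) * ψ (ω (n + 1)) ∂(chainLaw μ K) =
      ∫ p, g p ∂((chainLaw μ K).map
        fun ω ↦ (Preorder.frestrictLe (π := fun _ ↦ E) n ω, ω (n + 1))) :=
    (integral_map hm.aemeasurable hg.aestronglyMeasurable).symm
  have h2 : Integrable g ((chainLaw μ K).map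
        fun ω ↦ (Preorder.frestrictLe (π := fun _ ↦ E) n ω, ω (n + 1))) :=
    (integrable_map_measure hg.aestronglyMeasurable hm.aemeasurable).2 hint
  rw [← chainLaw_map_succ] at h1 h2
  rw [h1, Measure.integral_compProd h2, integral_map (by fun_prop)
    (integrable_integral_compProd h2).aestronglyMeasurable]
  refine integral_congr_ae ?_
  filter_upwards [(measurePreserving_chainLaw hrev n).quasiMeasurePreserving.ae
    (kernelOp_ae_eq hrev ψ)] with ω hω
  rw [hω]
  exact integral_const_mul (φ (ω i)) (fun y ↦ ψ y)

theorem inner_chainEval_add (i k : ℕ) (φ ψ : Lp ℝ 2 μ) :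
    ⟪chainEval hrev i φ, chainEval hrev (i + k) ψ⟫_ℝ = ⟪φ, (kernelOp hrev ^ k) ψ⟫_ℝ := by
  induction k generalizing ψ with
  | zero =>
    have h := (Lp.compMeasurePreservingₗᵢ ℝ (fun ω ↦ ω i) (measurePreserving_chainLaw hrev i) :
      Lp ℝ 2 μ →ₗᵢ[ℝ] Lp ℝ 2 (chainLaw μ K)).inner_map_map φ ψ
    rw [pow_zero, ContinuousLinearMap.one_def, ContinuousLinearMap.id_apply]
    exact h
  | succ k ih =>
    rw [← add_assoc, inner_chainEval_succ hrev (Nat.le_add_right i k), ih, pow_succ]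
    rfl

theorem norm_sum_chainEval_sq (F : Lp ℝ 2 μ) (n : ℕ) :
    ‖∑ k ∈ Finset.Icc 1 n, chainEval hrev k F‖ ^ 2 =
      2 * ⟪F, doubleGeomSum (kernelOp hrev) n F⟫_ℝ - n * ‖F‖ ^ 2 := by
  induction n with
  | zero => simp [doubleGeomSum]
  | succ n ih =>
    have h1 : ⟪∑ k ∈ Finset.Icc 1 n, chainEval hrev k F, chainEval hrev (n + 1) F⟫_ℝ =
        ⟪F, geomSum (kernelOp hrev) (n + 1) F⟫_ℝ - ‖F‖ ^ 2 := by
      have h2 : ∀ k ∈ Finset.range n,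
          ⟪chainEval hrev (n - k) F, chainEval hrev (n + 1) F⟫_ℝ =
            ⟪F, (kernelOp hrev ^ (k + 1)) F⟫_ℝ := by
        intro k hk
        have hk' := Finset.mem_range.1 hk
        rw [← inner_chainEval_add hrev (n - k) (k + 1), show n - k + (k + 1) = n + 1 by omega]
      rw [sum_inner, geomSum, Finset.sum_range_succ', add_apply, sum_apply, inner_add_right,
        inner_sum, ← Finset.sum_congr rfl h2]
      rw [pow_zero, ContinuousLinearMap.one_def, ContinuousLinearMap.id_apply, real_inner_self_eq_norm_sq, add_sub_cancel_right]
      -- Time reversal: the power of `T` is the lag `n + 1 - k`, which runs over `1, …, n`; the lag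
      -- `0` is the term `‖F‖²` already removed.
      refine Finset.sum_nbij' (fun k ↦ n - k) (fun k ↦ n - k) ?_ ?_ ?_ ?_ ?_
      all_goals intro k hk; simp only [Finset.mem_Icc, Finset.mem_range] at hk ⊢
      all_goals try omega
      rw [show n - (n - k) = k by omega]
    rw [Finset.sum_Icc_succ_top (by omega), norm_add_sq_real, ih, h1, norm_chainEval,
      doubleGeomSum, doubleGeomSum, Finset.sum_range_succ, add_apply, inner_add_right]
    push_cast
    ring

theorem memLp_sub_integral {f : E → ℝ} (hf2 : MemLp f 2 μ) :
    MemLp (fun x ↦ f x - ∫ y, f y ∂μ) 2 μ := hf2.sub (memLp_const _)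

theorem ofReal_norm_toLp_sq_eq_evariance {f : E → ℝ} (hf2 : MemLp f 2 μ) :
    ENNReal.ofReal (‖(memLp_sub_integral hf2).toLp _‖ ^ 2) = evariance f μ := by
  rw [ofReal_norm_sq_eq_lintegral, evariance_eq_lintegral_ofReal]
  refine lintegral_congr_ae ?_
  filter_upwards [(memLp_sub_integral hf2).coeFn_toLp] with x hx
  rw [hx]

theorem scaledVar_eq {f : E → ℝ} (hf2 : MemLp f 2 μ) (n : ℕ) :
    scaledVar μ K f n = (n : ℝ≥0∞)⁻¹ * ENNReal.ofReal
      (‖∑ k ∈ Finset.Icc 1 n, chainEval hrev k ((memLp_sub_integral hf2).toLp _)‖ ^ 2) := by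
  rw [scaledVar, ofReal_norm_sq_eq_lintegral]
  congr 1
  refine lintegral_congr_ae ?_
  set F := (memLp_sub_integral hf2).toLp _ with hF
  have h1 : ∀ k, chainEval hrev k F =ᵐ[chainLaw μ K] fun ω ↦ f (ω k) - ∫ y, f y ∂μ := by
    intro k
    filter_upwards [Lp.coeFn_compMeasurePreserving F (measurePreserving_chainLaw hrev k),
      (measurePreserving_chainLaw hrev k).quasiMeasurePreserving.ae
        (memLp_sub_integral hf2).coeFn_toLp] with ω h2 h3
    rw [chainEval, h2, Function.comp_apply, hF, h3]
  filter_upwards [Lp.coeFn_finsetSum (Finset.Icc 1 n) fun k ↦ chainEval hrev k F,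
    ae_all_iff.2 h1] with ω h2 h3
  rw [h2, Finset.sum_apply]
  simp [h3]

end Chain

/-! ### The variational formula for the asymptotic variance. -/

section Variational

open scoped InnerProductSpace

variable {E : Type*} [MeasurableSpace E]

/-- The supremum over `h ∈ L² (μ)` of `2 ⟨f, h⟩ - ½ ∫ μ (dx) Π (x, dy) (h (x) - h (y))²`. -/
noncomputable def dualForm (μ : Measure E) (K : Kernel E E) (f : E → ℝ) : ℝ≥0∞ :=
  ⨆ (h : E → ℝ) (_ : Measurable h) (_ : MemLp h 2 μ),
    ENNReal.ofReal (2 * ∫ x, f x * h x ∂μ) - dirichletForm μ K h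

variable {μ : Measure E} [IsProbabilityMeasure μ] {K : Kernel E E} [IsMarkovKernel K]

theorem isLUB_dualForm (hrev : (μ ⊗ₘ K).map Prod.swap = μ ⊗ₘ K) {f : E → ℝ}
    (hf2 : MemLp f 2 μ) (hfin : dualForm μ K f ≠ ∞) :
    IsLUB (Set.range fun h ↦ 2 * ⟪hf2.toLp f, h⟫_ℝ - ⟪h, h - kernelOp hrev h⟫_ℝ)
      (dualForm μ K f).toReal := by
  have key : ∀ (h : E → ℝ) (_ : Measurable h) (h2 : MemLp h 2 μ),
      ENNReal.ofReal (2 * ∫ x, f x * h x ∂μ) - dirichletForm μ K h =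
        ENNReal.ofReal (2 * ⟪hf2.toLp f, h2.toLp h⟫_ℝ -
          ⟪h2.toLp h, h2.toLp h - kernelOp hrev (h2.toLp h)⟫_ℝ) := by
    intro h hm h2
    rw [dirichletForm_eq_ofReal_inner hrev hm h2, inner_toLp_toLp hf2 h2,
      ENNReal.ofReal_sub _ (inner_sub_self_nonneg (norm_kernelOp_apply_le hrev) _)]
  constructor
  · rintro _ ⟨h, rfl⟩
    refine (ENNReal.ofReal_le_iff_le_toReal hfin).1 ?_
    have h1 := key h (Lp.stronglyMeasurable h).measurable (Lp.memLp h)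
    rw [Lp.toLp_coeFn] at h1
    rw [← h1]
    exact le_iSup_of_le (h : E → ℝ) <| le_iSup_of_le (Lp.stronglyMeasurable h).measurable <|
      le_iSup_of_le (Lp.memLp h) le_rfl
  · intro c hc
    -- The choice `h = 0` makes the supremum nonnegative, so truncating each term at `0` in `ℝ≥0∞`
    -- does not change it.
    have hc0 : 0 ≤ c := by simpa using hc ⟨0, rfl⟩
    refine ENNReal.toReal_le_of_le_ofReal hc0 ?_
    refine iSup_le fun h ↦ iSup_le fun hm ↦ iSup_le fun h2 ↦ ?_
    rw [key h hm h2]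
    exact ENNReal.ofReal_le_ofReal (hc ⟨_, rfl⟩)

/-- The limit defining the asymptotic variance of a reversible chain, in variational form. -/
theorem tendsto_scaledVar (hrev : (μ ⊗ₘ K).map Prod.swap = μ ⊗ₘ K) {f : E → ℝ}
    (hf2 : MemLp f 2 μ) (hfin : dualForm μ K (fun x ↦ f x - ∫ y, f y ∂μ) ≠ ∞) :
    Tendsto (scaledVar μ K f) atTop
      (𝓝 (2 * dualForm μ K (fun x ↦ f x - ∫ y, f y ∂μ) - evariance f μ)) := by
  set F := (memLp_sub_integral hf2).toLp _ with hF
  set S := dualForm μ K (fun x ↦ f x - ∫ y, f y ∂μ) with hS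
  have h1 := tendsto_inner_doubleGeomSum (inner_kernelOp_comm hrev) (norm_kernelOp_apply_le hrev)
    (isLUB_dualForm hrev (memLp_sub_integral hf2) hfin)
  rw [← hF, ← hS] at h1
  have h2 : 2 * S - evariance f μ = ENNReal.ofReal (2 * S.toReal - ‖F‖ ^ 2) := by
    rw [ENNReal.ofReal_sub _ (sq_nonneg _), ofReal_norm_toLp_sq_eq_evariance hf2,
      ENNReal.ofReal_mul zero_le_two, ENNReal.ofReal_toReal hfin, ENNReal.ofReal_ofNat]
  rw [h2]
  refine (ENNReal.tendsto_ofReal ((h1.const_mul 2).sub_const (‖F‖ ^ 2))).congr' ?_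
  filter_upwards [eventually_gt_atTop 0] with n hn
  have hn' : (0 : ℝ) < n := by exact_mod_cast hn
  rw [scaledVar_eq hrev hf2, ← hF, norm_sum_chainEval_sq, ← ENNReal.ofReal_natCast,
    ← ENNReal.ofReal_inv_of_pos hn', ← ENNReal.ofReal_mul (by positivity)]
  congr 1
  field_simp

theorem asympVar_eq (hrev : (μ ⊗ₘ K).map Prod.swap = μ ⊗ₘ K) {f : E → ℝ}
    (hf2 : MemLp f 2 μ) (hfin : dualForm μ K (fun x ↦ f x - ∫ y, f y ∂μ) ≠ ∞) :
    asympVar μ K f = 2 * dualForm μ K (fun x ↦ f x - ∫ y, f y ∂μ) - evariance f μ :=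
  (tendsto_scaledVar hrev hf2 hfin).limUnder_eq

end Variational

/-! ### Reversibility of Metropolis–Hastings kernels through a symmetric dominating measure. -/

section MetropolisHastings

variable {E : Type*} [MeasurableSpace E]

theorem lintegral_compProd_mhKernel (μ : Measure E) [SFinite μ] (q : Kernel E E)
    [IsMarkovKernel q] {r : E → E → ℝ≥0∞} (hr : Measurable (Function.uncurry r))
    {F : E × E → ℝ≥0∞} (hF : Measurable F) :
    ∫⁻ z, F z ∂(μ ⊗ₘ mhKernel q r hr) =
      ∫⁻ x, ∫⁻ y, min 1 (r x y) * F (x, y) ∂(q x) ∂μ + ∫⁻ x, rejectProb q r x * F (x, x) ∂μ := by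
  have hm := measurable_min_ratio hr
  rw [Measure.lintegral_compProd hF, ← lintegral_add_left]
  · refine lintegral_congr fun x ↦ ?_
    have hFx : Measurable fun y ↦ F (x, y) := hF.comp measurable_prodMk_left
    have hmx : Measurable fun y ↦ min 1 (r x y) := hm.comp measurable_prodMk_left
    rw [mhKernel_apply, lintegral_add_measure, lintegral_smul_measure, lintegral_dirac' _ hFx,
      lintegral_withDensity_eq_lintegral_mul _ hmx hFx]
    rfl
  · exact Measurable.lintegral_kernel_prod_right (hm.mul hF)

theorem map_swap_compProd_mhKernel (μ : Measure E) [SFinite μ] (q : Kernel E E)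
    [IsMarkovKernel q] {r : E → E → ℝ≥0∞} (hr : Measurable (Function.uncurry r))
    (hsymm : ∀ F : E × E → ℝ≥0∞, Measurable F →
      ∫⁻ x, ∫⁻ y, min 1 (r x y) * F (y, x) ∂(q x) ∂μ =
        ∫⁻ x, ∫⁻ y, min 1 (r x y) * F (x, y) ∂(q x) ∂μ) :
    (μ ⊗ₘ mhKernel q r hr).map Prod.swap = μ ⊗ₘ mhKernel q r hr := by
  refine Measure.ext_of_lintegral _ fun F hF ↦ ?_
  have hF' : Measurable fun z : E × E ↦ F z.swap := hF.comp measurable_swap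
  rw [lintegral_map hF measurable_swap, lintegral_compProd_mhKernel μ q hr hF,
    lintegral_compProd_mhKernel μ q hr hF']
  -- The rejection part lives on the diagonal and is invariant under the swap, so only the
  -- acceptance part has to be symmetric.
  congr 1
  exact hsymm F hF

theorem dirichletForm_mhKernel (μ : Measure E) [IsProbabilityMeasure μ] (q : Kernel E E)
    [IsMarkovKernel q] {r : E → E → ℝ≥0∞} (hr : Measurable (Function.uncurry r))
    {h : E → ℝ} (hh : Measurable h) :
    dirichletForm μ (mhKernel q r hr) h =
      2⁻¹ * ∫⁻ x, ∫⁻ y, min 1 (r x y) * ENNReal.ofReal ((h x - h y) ^ 2) ∂(q x) ∂μ := by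
  rw [dirichletForm_eq_lintegral_compProd hh, lintegral_compProd_mhKernel μ q hr (by fun_prop)]
  simp

/-- A symmetric measure `m` with respect to which `ν` has the density `a`, and hence the image of
`ν` under the swap the density `a ∘ swap`; the function `r` is the ratio of these densities. -/
structure IsSymmDensity (ν : Measure (E × E)) (r : E → E → ℝ≥0∞) (m : Measure (E × E))
    (a : E × E → ℝ≥0∞) : Prop where
  map_swap : m.map Prod.swap = m
  measurable : Measurable a
  withDensity : m.withDensity a = ν
  ratio : ∀ᵐ z ∂m, ∀ w u : ℝ≥0∞,
    a z * min w (r z.1 z.2 * u) = min (a z * w) (a z.swap * u)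

theorem exists_isSymmDensity (ν : Measure (E × E)) [IsFiniteMeasure ν] {r : E → E → ℝ≥0∞}
    (hr : Function.uncurry r =ᵐ[ν] (ν.map Prod.swap).rnDeriv ν) :
    ∃ (m : Measure (E × E)) (a : E × E → ℝ≥0∞), SFinite m ∧ IsSymmDensity ν r m a := by
  set ν' := ν.map Prod.swap with hν'
  have hν'fin : IsFiniteMeasure ν' := Measure.isFiniteMeasure_map ν _
  have hswap : ν'.map Prod.swap = ν := by
    rw [hν', Measure.map_map measurable_swap measurable_swap]; simp
  set m := ν + ν' with hm
  have hmm : m.map Prod.swap = m := by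
    rw [hm, Measure.map_add _ _ measurable_swap, hswap, ← hν', add_comm]
  have hmp : MeasurePreserving Prod.swap m m := ⟨measurable_swap, hmm⟩
  have hac : ν ≪ m := Measure.AbsolutelyContinuous.rfl.add_right _
  have hac' : ν' ≪ m := Measure.AbsolutelyContinuous.rfl.add_right' _
  set a := ν.rnDeriv m with ha
  have ham : Measurable a := Measure.measurable_rnDeriv _ _
  have hwd : m.withDensity a = ν := Measure.withDensity_rnDeriv_eq _ _ hac
  have hwd' : ν' = m.withDensity (fun z ↦ a z.swap) := by
    refine Measure.ext_of_lintegral _ fun F hF ↦ ?_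
    have hF' : Measurable fun z : E × E ↦ F z.swap := hF.comp measurable_swap
    have ham' : Measurable fun z : E × E ↦ a z.swap := ham.comp measurable_swap
    rw [hν', lintegral_map hF measurable_swap, ← hwd,
      lintegral_withDensity_eq_lintegral_mul _ ham hF',
      lintegral_withDensity_eq_lintegral_mul _ ham' hF,
      ← hmp.lintegral_comp (ham.mul hF')]
    simp
  have hd' : ν'.rnDeriv m =ᵐ[m] fun z ↦ a z.swap := by
    rw [hwd']; exact Measure.rnDeriv_withDensity _ (ham.comp measurable_swap)
  have hdiv := Measure.rnDeriv_eq_div hac' hac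
  have hra : ∀ᵐ z ∂ν, r z.1 z.2 = a z.swap / a z := by
    filter_upwards [hr, hdiv, hac hd'] with z h1 h2 h3
    rw [h2, h3] at h1
    exact h1
  -- `r` is determined only `ν`-almost everywhere, hence `m`-almost everywhere off `{a = 0}`; on `{a
  -- = 0}` both sides of `ratio` vanish.
  rw [← hwd, ae_withDensity_iff ham] at hra
  refine ⟨m, a, inferInstance, hmm, ham, hwd, ?_⟩
  filter_upwards [hra, ν.rnDeriv_lt_top m] with z h1 h2 w u
  rcases eq_or_ne (a z) 0 with h0 | h0
  · simp [h0]
  · rw [mul_min, h1 h0, ← mul_assoc, ENNReal.mul_div_cancel h0 h2.ne]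

variable {π : Measure E} [IsProbabilityMeasure π] {q : Kernel E E} [IsMarkovKernel q]
  {r : E → E → ℝ≥0∞} {m : Measure (E × E)} {a : E × E → ℝ≥0∞}

theorem IsSymmDensity.measurePreserving {ν : Measure (E × E)} (hm : IsSymmDensity ν r m a) :
    MeasurePreserving Prod.swap m m := ⟨measurable_swap, hm.map_swap⟩

theorem IsSymmDensity.lintegral_min_mul (hm : IsSymmDensity (π ⊗ₘ q) r m a)
    (hr : Measurable (Function.uncurry r)) {F : E × E → ℝ≥0∞} (hF : Measurable F) :
    ∫⁻ x, ∫⁻ y, min 1 (r x y) * F (x, y) ∂(q x) ∂π =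
      ∫⁻ p, min (a p) (a p.swap) * F p ∂m := by
  have h1 : Measurable fun p : E × E ↦ min 1 (r p.1 p.2) * F p := (measurable_min_ratio hr).mul hF
  rw [← Measure.lintegral_compProd (μ := π) (κ := q) h1, ← hm.withDensity,
    lintegral_withDensity_eq_lintegral_mul _ hm.measurable h1]
  refine lintegral_congr_ae ?_
  filter_upwards [hm.ratio] with p hp
  have := hp 1 1
  rw [mul_one, mul_one, mul_one] at this
  rw [Pi.mul_apply, ← mul_assoc, this]

theorem IsSymmDensity.map_swap_mhKernel (hm : IsSymmDensity (π ⊗ₘ q) r m a)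
    (hr : Measurable (Function.uncurry r)) :
    (π ⊗ₘ mhKernel q r hr).map Prod.swap = π ⊗ₘ mhKernel q r hr := by
  refine map_swap_compProd_mhKernel π q hr fun F hF ↦ ?_
  have ha := hm.measurable
  rw [hm.lintegral_min_mul hr hF, ← hm.measurePreserving.lintegral_comp (by fun_prop)]
  refine (hm.lintegral_min_mul hr (hF.comp measurable_swap)).trans (lintegral_congr fun p ↦ ?_)
  rw [Prod.swap_swap, min_comm]
  rfl

end MetropolisHastings

/-! ### The pseudo-marginal kernel in terms of the symmetric density. -/

section Pseudo

variable {X : Type*} [MeasurableSpace X] {W : Set ℝ≥0}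
  {π : Measure X} [IsProbabilityMeasure π] {q : Kernel X X} [IsMarkovKernel q]
  {r : X → X → ℝ≥0∞} {m : Measure (X × X)} {a : X × X → ℝ≥0∞}
  {Q : Kernel X W} [IsMarkovKernel Q]

variable (Q) in
/-- The kernel `w Q_x (dw)`. -/
noncomputable def weightedKernel : Kernel X W := Q.withDensity fun _ w ↦ weight w

theorem weightedKernel_apply (x : X) : weightedKernel Q x = (Q x).withDensity weight :=
  Kernel.withDensity_apply (f := fun _ w ↦ weight w) Q
    (measurable_weight.comp measurable_snd) x

theorem HasMeanOne.isMarkovKernel (hQ : HasMeanOne Q) : IsMarkovKernel (weightedKernel Q) := by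
  refine ⟨fun x ↦ ⟨?_⟩⟩
  rw [weightedKernel_apply, withDensity_apply _ MeasurableSet.univ, setLIntegral_univ, hQ x]

theorem lintegral_weightedKernel (x : X) {F : W → ℝ≥0∞} (hF : Measurable F) :
    ∫⁻ w, F w ∂(weightedKernel Q x) = ∫⁻ w, weight w * F w ∂(Q x) := by
  rw [weightedKernel_apply, lintegral_withDensity_eq_lintegral_mul _ measurable_weight hF]
  rfl

theorem pseudoTarget_eq (π : Measure X) (Q : Kernel X W) [IsMarkovKernel Q] :
    pseudoTarget π Q = π ⊗ₘ weightedKernel Q := rfl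

theorem HasMeanOne.isProbabilityMeasure (hQ : HasMeanOne Q) :
    IsProbabilityMeasure (pseudoTarget π Q) := by
  have := hQ.isMarkovKernel
  rw [pseudoTarget_eq]; infer_instance

theorem HasMeanOne.measurePreserving_fst (hQ : HasMeanOne Q) :
    MeasurePreserving Prod.fst (pseudoTarget π Q) π := by
  have := hQ.isMarkovKernel
  exact ⟨measurable_fst, Measure.fst_compProd π (weightedKernel Q)⟩

theorem weight_ne_top (w : W) : weight w ≠ ∞ := ENNReal.coe_ne_top

/-- The factor `w` of the target cancels the denominator of `u / w`; at `w = 0` both sides vanish,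
whatever the value of the quotient. -/
theorem weight_mul_min_one (s u : ℝ≥0∞) (w : W) :
    weight w * min 1 (s * (u / weight w)) = min (weight w) (s * u) := by
  rcases eq_or_ne (weight w) 0 with h0 | h0
  · simp [h0]
  · rw [mul_min, mul_one, mul_left_comm, ENNReal.mul_div_cancel h0 (weight_ne_top w)]

theorem lintegral_pseudoProposal (z : X × W) {F : X × W → ℝ≥0∞} (hF : Measurable F) :
    ∫⁻ z', F z' ∂(pseudoProposal q Q z) = ∫⁻ y, ∫⁻ u, F (y, u) ∂(Q y) ∂(q z.1) := by
  rw [pseudoProposal, Kernel.comap_apply, Kernel.lintegral_compProd _ _ _ hF]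
  rfl

theorem IsSymmDensity.lintegral_min_mul_pseudo [SFinite m]
    (hm : IsSymmDensity (π ⊗ₘ q) r m a) (hQ : HasMeanOne Q)
    (hr : Measurable (Function.uncurry r)) {F : (X × W) × (X × W) → ℝ≥0∞} (hF : Measurable F) :
    ∫⁻ z, ∫⁻ z', min 1 (pseudoRatio r z z') * F (z, z') ∂(pseudoProposal q Q z)
        ∂(pseudoTarget π Q) =
      ∫⁻ p, ∫⁻ w, ∫⁻ u, min (a p * weight w) (a p.swap * weight u) * F ((p.1, w), (p.2, u))
        ∂(Q p.2) ∂(Q p.1) ∂m := by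
  have := hQ.isMarkovKernel
  have hw : Measurable (weight : W → ℝ≥0∞) := measurable_weight
  have hr' : Measurable fun p : X × X ↦ r p.1 p.2 := hr
  have ha := hm.measurable
  have hG : Measurable fun p : (X × W) × (X × W) ↦ min 1 (pseudoRatio r p.1 p.2) * F p :=
    (measurable_min_ratio (measurable_pseudoRatio hr)).mul hF
  have hK : Measurable fun p : (X × X) × (W × W) ↦
      min (weight p.2.1) (r p.1.1 p.1.2 * weight p.2.2) *
        F ((p.1.1, p.2.1), (p.1.2, p.2.2)) := by fun_prop
  have hK1 : Measurable fun p : (X × X) × W ↦ ∫⁻ u, min (weight p.2) (r p.1.1 p.1.2 * weight u) *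
        F ((p.1.1, p.2), (p.1.2, u)) ∂(Q p.1.2) := by
    have : Measurable fun t : ((X × X) × W) × W ↦
      min (weight t.1.2) (r t.1.1.1 t.1.1.2 * weight t.2) *
        F ((t.1.1.1, t.1.2), (t.1.1.2, t.2)) := by fun_prop
    exact Measurable.lintegral_kernel_prod_right' (κ := Q.comap (fun p : (X × X) × W ↦ p.1.2)
      (by fun_prop)) this
  have hK2 : Measurable fun p : X × X ↦ ∫⁻ w, ∫⁻ u, min (weight w) (r p.1 p.2 * weight u) *
        F ((p.1, w), (p.2, u)) ∂(Q p.2) ∂(Q p.1) :=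
    Measurable.lintegral_kernel_prod_right' (κ := Q.comap (fun p : X × X ↦ p.1)
      (by fun_prop)) hK1
  have e1 : ∫⁻ z, ∫⁻ z', min 1 (pseudoRatio r z z') * F (z, z') ∂(pseudoProposal q Q z)
        ∂(pseudoTarget π Q) = ∫⁻ x, ∫⁻ y, ∫⁻ w, ∫⁻ u, min (weight w) (r x y * weight u) *
        F ((x, w), (y, u)) ∂(Q y) ∂(Q x) ∂(q x) ∂π := by
    rw [pseudoTarget_eq, Measure.lintegral_compProd
      (Measurable.lintegral_kernel_prod_right' (κ := pseudoProposal q Q) hG)]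
    refine lintegral_congr fun x ↦ ?_
    have hx : Measurable fun w : W ↦ ∫⁻ z', min 1 (pseudoRatio r (x, w) z') * F ((x, w), z')
        ∂(pseudoProposal q Q (x, w)) :=
      (Measurable.lintegral_kernel_prod_right' (κ := pseudoProposal q Q) hG).comp
        measurable_prodMk_left
    rw [lintegral_weightedKernel x hx, lintegral_lintegral_swap]
    · refine lintegral_congr fun w ↦ ?_
      have hGw : Measurable fun z' : X × W ↦ min 1 (pseudoRatio r (x, w) z') * F ((x, w), z') :=
        hG.comp measurable_prodMk_left
      rw [lintegral_pseudoProposal _ hGw, ← lintegral_const_mul _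
        (Measurable.lintegral_kernel_prod_right' (κ := Q) hGw)]
      refine lintegral_congr fun y ↦ ?_
      have hGy : Measurable fun u : W ↦ min 1 (pseudoRatio r (x, w) (y, u)) *
        F ((x, w), (y, u)) := hGw.comp measurable_prodMk_left
      rw [← lintegral_const_mul _ hGy]
      refine lintegral_congr fun u ↦ ?_
      rw [← mul_assoc]
      congr 1
      exact weight_mul_min_one _ _ _
    · exact (hK1.comp (by fun_prop : Measurable fun t : X × W ↦ ((x, t.1), t.2))).aemeasurable
  rw [e1, ← Measure.lintegral_compProd (μ := π) (κ := q) hK2, ← hm.withDensity,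
    lintegral_withDensity_eq_lintegral_mul _ hm.measurable hK2]
  refine lintegral_congr_ae ?_
  filter_upwards [hm.ratio] with p hp
  have hKp : Measurable fun w : W ↦ ∫⁻ u, min (weight w) (r p.1 p.2 * weight u) *
        F ((p.1, w), (p.2, u)) ∂(Q p.2) := hK1.comp measurable_prodMk_left
  rw [Pi.mul_apply, ← lintegral_const_mul _ hKp]
  refine lintegral_congr fun w ↦ ?_
  have hKw : Measurable fun u : W ↦ min (weight w) (r p.1 p.2 * weight u) *
        F ((p.1, w), (p.2, u)) := by fun_prop
  rw [← lintegral_const_mul _ hKw]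
  refine lintegral_congr fun u ↦ ?_
  rw [← mul_assoc, hp]

theorem IsSymmDensity.map_swap_pseudoKernel [SFinite m]
    (hm : IsSymmDensity (π ⊗ₘ q) r m a) (hQ : HasMeanOne Q)
    (hr : Measurable (Function.uncurry r)) :
    (pseudoTarget π Q ⊗ₘ pseudoKernel q r hr Q).map Prod.swap =
      pseudoTarget π Q ⊗ₘ pseudoKernel q r hr Q := by
  have := hQ.isProbabilityMeasure (π := π)
  have hw : Measurable (weight : W → ℝ≥0∞) := measurable_weight
  have ha := hm.measurable
  refine map_swap_compProd_mhKernel _ _ _ fun F hF ↦ ?_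
  have hK1 : Measurable fun p : (X × X) × W ↦ ∫⁻ u, min (a p.1 * weight p.2)
      (a p.1.swap * weight u) * F ((p.1.1, p.2), (p.1.2, u)) ∂(Q p.1.2) := by
    have : Measurable fun t : ((X × X) × W) × W ↦
      min (a t.1.1 * weight t.1.2) (a t.1.1.swap * weight t.2) *
        F ((t.1.1.1, t.1.2), (t.1.1.2, t.2)) := by fun_prop
    exact Measurable.lintegral_kernel_prod_right' (κ := Q.comap (fun p : (X × X) × W ↦ p.1.2)
      (by fun_prop)) this
  have hK2 : Measurable fun p : X × X ↦ ∫⁻ w, ∫⁻ u, min (a p * weight w)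
      (a p.swap * weight u) * F ((p.1, w), (p.2, u)) ∂(Q p.2) ∂(Q p.1) :=
    Measurable.lintegral_kernel_prod_right' (κ := Q.comap (fun p : X × X ↦ p.1)
      (by fun_prop)) hK1
  rw [hm.lintegral_min_mul_pseudo hQ hr hF, ← hm.measurePreserving.lintegral_comp hK2]
  refine (hm.lintegral_min_mul_pseudo hQ hr (hF.comp measurable_swap)).trans
    (lintegral_congr fun p ↦ ?_)
  rw [lintegral_lintegral_swap]
  · refine lintegral_congr fun u ↦ lintegral_congr fun w ↦ ?_
    rw [Prod.swap_swap, min_comm]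
    rfl
  · have : Measurable fun t : W × W ↦ min (a p * weight t.1) (a p.swap * weight t.2) *
      (F ∘ Prod.swap) ((p.1, t.1), (p.2, t.2)) := by fun_prop
    exact this.aemeasurable

theorem IsSymmDensity.dirichletForm_marginal (hm : IsSymmDensity (π ⊗ₘ q) r m a)
    (hr : Measurable (Function.uncurry r)) {h : X → ℝ} (hh : Measurable h) :
    dirichletForm π (mhKernel q r hr) h =
      2⁻¹ * ∫⁻ p, min (a p) (a p.swap) * ENNReal.ofReal ((h p.1 - h p.2) ^ 2) ∂m := by
  rw [dirichletForm_mhKernel π q hr hh]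
  congr 1
  exact hm.lintegral_min_mul hr (F := fun p ↦ ENNReal.ofReal ((h p.1 - h p.2) ^ 2)) (by fun_prop)

theorem IsSymmDensity.dirichletForm_pseudo [SFinite m]
    (hm : IsSymmDensity (π ⊗ₘ q) r m a) (hQ : HasMeanOne Q)
    (hr : Measurable (Function.uncurry r)) {h : X × W → ℝ} (hh : Measurable h) :
    dirichletForm (pseudoTarget π Q) (pseudoKernel q r hr Q) h =
      2⁻¹ * ∫⁻ p, ∫⁻ w, ∫⁻ u, min (a p * weight w) (a p.swap * weight u) *
        ENNReal.ofReal ((h (p.1, w) - h (p.2, u)) ^ 2) ∂(Q p.2) ∂(Q p.1) ∂m := by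
  have := hQ.isProbabilityMeasure (π := π)
  rw [pseudoKernel, dirichletForm_mhKernel _ _ _ hh]
  congr 1
  exact hm.lintegral_min_mul_pseudo hQ hr
    (F := fun p ↦ ENNReal.ofReal ((h p.1 - h p.2) ^ 2)) (by fun_prop)

end Pseudo

/-! ### Jensen's inequality for squares and for squared differences. -/

section Jensen

variable {E F : Type*} [MeasurableSpace E] [MeasurableSpace F]

theorem memLp_two_of_lintegral_ne_top {μ : Measure E} {f : E → ℝ} (hf : AEStronglyMeasurable f μ)
    (h : ∫⁻ x, ENNReal.ofReal (f x ^ 2) ∂μ ≠ ∞) : MemLp f 2 μ := by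
  refine (memLp_two_iff_integrable_sq hf).2 ⟨hf.pow 2, ?_⟩
  rw [hasFiniteIntegral_iff_ofReal (Eventually.of_forall fun x ↦ sq_nonneg _)]
  exact h.lt_top

theorem lintegral_ofReal_sq_ne_top {μ : Measure E} {f : E → ℝ} (hf : MemLp f 2 μ) :
    ∫⁻ x, ENNReal.ofReal (f x ^ 2) ∂μ ≠ ∞ := by
  have h := hf.integrable_sq.2
  rw [hasFiniteIntegral_iff_ofReal (Eventually.of_forall fun x ↦ sq_nonneg _)] at h
  exact h.ne

theorem ofReal_sq_integral_le {μ : Measure E} [IsProbabilityMeasure μ] {f : E → ℝ}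
    (hf : AEStronglyMeasurable f μ) :
    ENNReal.ofReal ((∫ x, f x ∂μ) ^ 2) ≤ ∫⁻ x, ENNReal.ofReal (f x ^ 2) ∂μ := by
  by_cases h : ∫⁻ x, ENNReal.ofReal (f x ^ 2) ∂μ = ∞
  · rw [h]; exact le_top
  have h2 := memLp_two_of_lintegral_ne_top hf h
  rw [← ofReal_integral_eq_lintegral_ofReal h2.integrable_sq
    (Eventually.of_forall fun x ↦ sq_nonneg _)]
  refine ENNReal.ofReal_le_ofReal ?_
  have h3 := variance_nonneg f μ
  rw [variance_eq_sub h2] at h3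
  simpa using h3

/-- Jensen on the product measure. No integrability is assumed: if the right side is finite, `f z.1
- g z.2` is integrable, and almost every section of it shows that `f` and `g` are integrable
separately. -/
theorem ofReal_sq_integral_sub_integral_le {μ : Measure E} [IsProbabilityMeasure μ]
    {ν : Measure F} [IsProbabilityMeasure ν] {f : E → ℝ} (hf : Measurable f) {g : F → ℝ}
    (hg : Measurable g) :
    ENNReal.ofReal ((∫ x, f x ∂μ - ∫ y, g y ∂ν) ^ 2) ≤
      ∫⁻ x, ∫⁻ y, ENNReal.ofReal ((f x - g y) ^ 2) ∂ν ∂μ := by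
  have hm : Measurable fun z : E × F ↦ f z.1 - g z.2 := by fun_prop
  have hm2 : Measurable fun z : E × F ↦ ENNReal.ofReal ((f z.1 - g z.2) ^ 2) := by fun_prop
  have e : ∫⁻ x, ∫⁻ y, ENNReal.ofReal ((f x - g y) ^ 2) ∂ν ∂μ =
      ∫⁻ z, ENNReal.ofReal ((f z.1 - g z.2) ^ 2) ∂(μ.prod ν) :=
    (lintegral_prod _ hm2.aemeasurable).symm
  rw [e]
  by_cases h : ∫⁻ z, ENNReal.ofReal ((f z.1 - g z.2) ^ 2) ∂(μ.prod ν) = ∞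
  · rw [h]; exact le_top
  have hi : Integrable (fun z : E × F ↦ f z.1 - g z.2) (μ.prod ν) :=
    (memLp_two_of_lintegral_ne_top hm.aestronglyMeasurable h).integrable one_le_two
  have hfi : Integrable f μ := by
    obtain ⟨y, hy⟩ := hi.prod_left_ae.exists
    exact (hy.add (integrable_const (g y))).congr (Eventually.of_forall fun x ↦ by simp)
  have hgi : Integrable g ν := by
    obtain ⟨x, hx⟩ := hi.prod_right_ae.exists
    exact ((integrable_const (f x)).sub hx).congr (Eventually.of_forall fun y ↦ by simp)
  refine le_trans (le_of_eq ?_) (ofReal_sq_integral_le hm.aestronglyMeasurable)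
  have h1 : Integrable (fun z : E × F ↦ f z.1) (μ.prod ν) := hfi.comp_fst ν
  have h2 : Integrable (fun z : E × F ↦ g z.2) (μ.prod ν) := hgi.comp_snd μ
  rw [integral_sub h1 h2, integral_fun_fst, integral_fun_snd]
  simp

end Jensen

/-! ### Comparison of the Dirichlet forms and of the dual forms. -/

section Comparison

theorem WeightsBoundedBy.ae_weight_le {X : Type*} [MeasurableSpace X] {W : Set ℝ≥0}
    {Q : Kernel X W} [IsMarkovKernel Q] {μ : Measure X} {b : ℝ} (hb : WeightsBoundedBy μ Q b) :
    ∀ᵐ x ∂μ, ∀ᵐ w ∂(Q x), weight w ≤ ENNReal.ofReal b := by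
  filter_upwards [hb] with x hx
  have hs : MeasurableSet {w : W | ((w : ℝ≥0) : ℝ) ≤ b} :=
    measurableSet_le (by fun_prop) measurable_const
  filter_upwards [(prob_compl_eq_zero_iff hs).2 hx |> measure_eq_zero_iff_ae_notMem.1] with w hw
  simp only [Set.mem_compl_iff, Set.mem_ofPred_eq, not_not] at hw
  rw [weight, ← ENNReal.ofReal_coe_nnreal]
  exact ENNReal.ofReal_le_ofReal hw

variable {X : Type*} [MeasurableSpace X] {W : Set ℝ≥0}
  {π : Measure X} [IsProbabilityMeasure π] {q : Kernel X X} [IsMarkovKernel q]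
  {r : X → X → ℝ≥0∞} {m : Measure (X × X)} {a : X × X → ℝ≥0∞}
  {Q : Kernel X W} [IsMarkovKernel Q]

/-- The integral of a minimum is at most the minimum of the integrals, and mean-one weights turn `∫∫
min (a w, a' u)` into at most `min (a, a')`. -/
theorem IsSymmDensity.dirichletForm_pseudo_le [SFinite m]
    (hm : IsSymmDensity (π ⊗ₘ q) r m a) (hQ : HasMeanOne Q)
    (hr : Measurable (Function.uncurry r)) {h : X → ℝ} (hh : Measurable h) :
    dirichletForm (pseudoTarget π Q) (pseudoKernel q r hr Q) (fun z ↦ h z.1) ≤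
      dirichletForm π (mhKernel q r hr) h := by
  have hw : Measurable (weight : W → ℝ≥0∞) := measurable_weight
  rw [hm.dirichletForm_pseudo hQ hr (by fun_prop), hm.dirichletForm_marginal hr hh]
  gcongr with p
  have h1 : ∀ w : W, ∫⁻ u, min (a p * weight w) (a p.swap * weight u) *
      ENNReal.ofReal ((h p.1 - h p.2) ^ 2) ∂(Q p.2) =
      (∫⁻ u, min (a p * weight w) (a p.swap * weight u) ∂(Q p.2)) *
        ENNReal.ofReal ((h p.1 - h p.2) ^ 2) :=
    fun w ↦ lintegral_mul_const _ (by fun_prop)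
  simp only [h1]
  have h2 : Measurable fun t : W × W ↦ min (a p * weight t.1) (a p.swap * weight t.2) := by
    fun_prop
  rw [lintegral_mul_const _ (h2.lintegral_prod_right')]
  gcongr
  refine le_min ?_ ?_
  · calc ∫⁻ w, ∫⁻ u, min (a p * weight w) (a p.swap * weight u) ∂(Q p.2) ∂(Q p.1)
        ≤ ∫⁻ w, ∫⁻ u, a p * weight w ∂(Q p.2) ∂(Q p.1) :=
          lintegral_mono fun w ↦ lintegral_mono fun u ↦ min_le_left _ _
      _ = a p := by simp [lintegral_const_mul _ hw, hQ p.1]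
  · calc ∫⁻ w, ∫⁻ u, min (a p * weight w) (a p.swap * weight u) ∂(Q p.2) ∂(Q p.1)
        ≤ ∫⁻ w, ∫⁻ u, a p.swap * weight u ∂(Q p.2) ∂(Q p.1) :=
          lintegral_mono fun w ↦ lintegral_mono fun u ↦ min_le_right _ _
      _ = a p.swap := by simp [lintegral_const_mul _ hw, hQ p.2]

/-- A `π`-almost sure property, such as the bound on the weights, is needed at both coordinates of
`m`-almost every pair that contributes to the forms. The first coordinate comes from the density
`a`, the second from the symmetry of `m`. -/
theorem IsSymmDensity.ae_of_ae {ν : X → Prop} (hm : IsSymmDensity (π ⊗ₘ q) r m a)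
    (h : ∀ᵐ x ∂π, ν x) : ∀ᵐ p ∂m, min (a p) (a p.swap) ≠ 0 → ν p.1 ∧ ν p.2 := by
  have h1 : ∀ᵐ p ∂(π ⊗ₘ q), ν p.1 := (measurePreserving_fst_compProd π q).quasiMeasurePreserving.ae h
  rw [← hm.withDensity, ae_withDensity_iff hm.measurable] at h1
  filter_upwards [h1, hm.measurePreserving.quasiMeasurePreserving.ae h1] with p h2 h3 h4
  exact ⟨h2 fun h0 ↦ h4 (by simp [h0]), h3 fun h0 ↦ h4 (by simp [h0])⟩

/-- The conditional expectation `x ↦ ∫ h (x, w) w Q_x (dw)`. -/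
noncomputable def weightedMean (Q : Kernel X W) [IsMarkovKernel Q] (h : X × W → ℝ) (x : X) : ℝ :=
  ∫ w, h (x, w) ∂(weightedKernel Q x)

theorem HasMeanOne.measurable_weightedMean (hQ : HasMeanOne Q) {h : X × W → ℝ}
    (hh : Measurable h) : Measurable (weightedMean Q h) := by
  have := hQ.isMarkovKernel
  exact (StronglyMeasurable.integral_kernel_prod_right' (κ := weightedKernel Q)
    hh.stronglyMeasurable).measurable

theorem HasMeanOne.memLp_weightedMean (hQ : HasMeanOne Q) {h : X × W → ℝ}
    (hh : Measurable h) (h2 : MemLp h 2 (pseudoTarget π Q)) : MemLp (weightedMean Q h) 2 π := by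
  have := hQ.isMarkovKernel
  refine memLp_two_of_lintegral_ne_top (hQ.measurable_weightedMean hh).aestronglyMeasurable ?_
  refine ne_top_of_le_ne_top (lintegral_ofReal_sq_ne_top h2) ?_
  rw [pseudoTarget_eq, Measure.lintegral_compProd (by fun_prop)]
  exact lintegral_mono fun x ↦
    ofReal_sq_integral_le (hh.comp measurable_prodMk_left).aestronglyMeasurable

theorem HasMeanOne.integral_mul_weightedMean (hQ : HasMeanOne Q) {f : X → ℝ} (hf2 : MemLp f 2 π)
    {h : X × W → ℝ} (h2 : MemLp h 2 (pseudoTarget π Q)) :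
    ∫ z, f z.1 * h z ∂(pseudoTarget π Q) = ∫ x, f x * weightedMean Q h x ∂π := by
  have := hQ.isMarkovKernel
  have h3 : Integrable (fun z : X × W ↦ f z.1 * h z) (pseudoTarget π Q) :=
    (hf2.comp_measurePreserving hQ.measurePreserving_fst).integrable_mul h2
  rw [pseudoTarget_eq] at h3 ⊢
  rw [Measure.integral_compProd h3]
  exact integral_congr_ae (Eventually.of_forall fun x ↦ integral_const_mul (f x) _)

/-- Jensen under `w Q_x(dw) u Q_y(du)` brings in the factor `w u`, which is absorbed by `b⁻¹ min (a,
a') w u ≤ min (a w, a' u)`: one of the weights cancels against `b` in each branch of the minimum. -/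
theorem IsSymmDensity.le_dirichletForm_pseudo [SFinite m]
    (hm : IsSymmDensity (π ⊗ₘ q) r m a) (hQ : HasMeanOne Q)
    (hr : Measurable (Function.uncurry r)) {b : ℝ} (hb1 : 1 ≤ b) (hb : WeightsBoundedBy π Q b)
    {h : X × W → ℝ} (hh : Measurable h) :
    (ENNReal.ofReal b)⁻¹ * dirichletForm π (mhKernel q r hr) (weightedMean Q h) ≤
      dirichletForm (pseudoTarget π Q) (pseudoKernel q r hr Q) h := by
  have := hQ.isMarkovKernel
  have hw : Measurable (weight : W → ℝ≥0∞) := measurable_weight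
  have hb0 : ENNReal.ofReal b ≠ 0 := by simp; linarith
  rw [hm.dirichletForm_pseudo hQ hr hh,
    hm.dirichletForm_marginal hr (hQ.measurable_weightedMean hh), mul_left_comm]
  gcongr
  rw [← lintegral_const_mul' _ _ (ENNReal.inv_ne_top.2 hb0)]
  refine lintegral_mono_ae ?_
  filter_upwards [hm.ae_of_ae hb.ae_weight_le] with p hp
  rcases eq_or_ne (min (a p) (a p.swap)) 0 with h0 | h0
  · simp [h0]
  obtain ⟨hp1, hp2⟩ := hp h0
  set c := (ENNReal.ofReal b)⁻¹ * min (a p) (a p.swap) with hc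
  have hjen := ofReal_sq_integral_sub_integral_le (μ := weightedKernel Q p.1)
    (ν := weightedKernel Q p.2) (f := fun w ↦ h (p.1, w)) (g := fun u ↦ h (p.2, u))
    (by fun_prop) (by fun_prop)
  have hmeas : Measurable fun t : W × W ↦ ENNReal.ofReal ((h (p.1, t.1) - h (p.2, t.2)) ^ 2) := by
    fun_prop
  have hle : ∀ v : W, weight v ≤ ENNReal.ofReal b → (ENNReal.ofReal b)⁻¹ * weight v ≤ 1 :=
    fun v hv ↦ by
      rw [← ENNReal.inv_mul_cancel hb0 ENNReal.ofReal_ne_top]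
      gcongr
  calc (ENNReal.ofReal b)⁻¹ * (min (a p) (a p.swap) *
        ENNReal.ofReal ((weightedMean Q h p.1 - weightedMean Q h p.2) ^ 2))
      ≤ c * ∫⁻ w, ∫⁻ u, ENNReal.ofReal ((h (p.1, w) - h (p.2, u)) ^ 2)
          ∂(weightedKernel Q p.2) ∂(weightedKernel Q p.1) := by
        rw [← mul_assoc]
        gcongr
        exact hjen
    _ = c * ∫⁻ w, ∫⁻ u, weight w * (weight u * ENNReal.ofReal ((h (p.1, w) - h (p.2, u)) ^ 2))
          ∂(Q p.2) ∂(Q p.1) := by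
        rw [lintegral_weightedKernel _ hmeas.lintegral_prod_right']
        congr 1
        refine lintegral_congr fun w ↦ ?_
        rw [lintegral_weightedKernel _ (by fun_prop), lintegral_const_mul _ (by fun_prop)]
    _ = ∫⁻ w, ∫⁻ u, c * (weight w * (weight u *
          ENNReal.ofReal ((h (p.1, w) - h (p.2, u)) ^ 2))) ∂(Q p.2) ∂(Q p.1) := by
        have hm2 : Measurable fun t : W × W ↦ weight t.1 * (weight t.2 *
          ENNReal.ofReal ((h (p.1, t.1) - h (p.2, t.2)) ^ 2)) := by fun_prop
        rw [← lintegral_const_mul _ hm2.lintegral_prod_right']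
        refine lintegral_congr fun w ↦ ?_
        rw [← lintegral_const_mul _ (by fun_prop)]
    _ ≤ _ := by
        refine lintegral_mono_ae ?_
        filter_upwards [hp1] with w hw1
        refine lintegral_mono_ae ?_
        filter_upwards [hp2] with u hu1
        rw [← mul_assoc, ← mul_assoc]
        gcongr
        refine le_min ?_ ?_
        · calc c * weight w * weight u
              = min (a p) (a p.swap) * weight w * ((ENNReal.ofReal b)⁻¹ * weight u) := by
                rw [hc]; ring
            _ ≤ a p * weight w * 1 := by
                gcongr
                exacts [min_le_left _ _, hle u hu1]
            _ = a p * weight w := mul_one _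
        · calc c * weight w * weight u
              = min (a p) (a p.swap) * weight u * ((ENNReal.ofReal b)⁻¹ * weight w) := by
                rw [hc]; ring
            _ ≤ a p.swap * weight u * 1 := by
                gcongr
                exacts [min_le_right _ _, hle w hw1]
            _ = a p.swap * weight u := mul_one _

theorem dirichletForm_const_mul {E : Type*} [MeasurableSpace E] (μ : Measure E)
    (K : Kernel E E) {c : ℝ} (h : E → ℝ) :
    dirichletForm μ K (fun x ↦ c * h x) = ENNReal.ofReal (c ^ 2) * dirichletForm μ K h := by
  rw [dirichletForm, dirichletForm, mul_left_comm, ← lintegral_const_mul' _ _ ENNReal.ofReal_ne_top]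
  congr 1
  refine lintegral_congr fun x ↦ ?_
  rw [← lintegral_const_mul' _ _ ENNReal.ofReal_ne_top]
  refine lintegral_congr fun y ↦ ?_
  rw [← ENNReal.ofReal_mul (sq_nonneg c)]
  congr 1; ring

theorem IsSymmDensity.dualForm_le_dualForm_pseudo [SFinite m]
    (hm : IsSymmDensity (π ⊗ₘ q) r m a) (hQ : HasMeanOne Q)
    (hr : Measurable (Function.uncurry r)) {f : X → ℝ} (hf : Measurable f) :
    dualForm π (mhKernel q r hr) f ≤
      dualForm (pseudoTarget π Q) (pseudoKernel q r hr Q) (fun z ↦ f z.1) := by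
  refine iSup_le fun h ↦ iSup_le fun hh ↦ iSup_le fun h2 ↦ ?_
  refine le_iSup_of_le (fun z ↦ h z.1) <| le_iSup_of_le (by fun_prop) <|
    le_iSup_of_le (h2.comp_measurePreserving hQ.measurePreserving_fst) ?_
  have e : ∫ z, f z.1 * h z.1 ∂(pseudoTarget π Q) = ∫ x, f x * h x ∂π := by
    have h3 := integral_map (μ := pseudoTarget π Q) measurable_fst.aemeasurable
      (hf.mul hh).aestronglyMeasurable
    rw [hQ.measurePreserving_fst.map_eq] at h3
    exact h3.symm
  rw [e]
  exact tsub_le_tsub_left (hm.dirichletForm_pseudo_le hQ hr hh) _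

theorem IsSymmDensity.dualForm_pseudo_le [SFinite m]
    (hm : IsSymmDensity (π ⊗ₘ q) r m a) (hQ : HasMeanOne Q)
    (hr : Measurable (Function.uncurry r)) {b : ℝ} (hb1 : 1 ≤ b) (hb : WeightsBoundedBy π Q b)
    {f : X → ℝ} (hf2 : MemLp f 2 π) :
    dualForm (pseudoTarget π Q) (pseudoKernel q r hr Q) (fun z ↦ f z.1) ≤
      ENNReal.ofReal b * dualForm π (mhKernel q r hr) f := by
  have hb0 : 0 < b := by linarith
  refine iSup_le fun h ↦ iSup_le fun hh ↦ iSup_le fun h2 ↦ ?_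
  set k := weightedMean Q h with hk
  have hkm : Measurable k := hQ.measurable_weightedMean hh
  have hk2 : MemLp k 2 π := hQ.memLp_weightedMean hh h2
  -- The scaling `b⁻¹` is chosen so that `b` times this value is `2 ⟪f, k⟫` minus `b⁻¹` times the
  -- form of `k`.
  have h3 : ENNReal.ofReal (2 * ∫ x, f x * (b⁻¹ * k x) ∂π) -
      dirichletForm π (mhKernel q r hr) (fun x ↦ b⁻¹ * k x) ≤ dualForm π (mhKernel q r hr) f :=
    le_iSup_of_le (fun x ↦ b⁻¹ * k x) <| le_iSup_of_le (by fun_prop) <|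
      le_iSup_of_le (hk2.const_mul b⁻¹) le_rfl
  have h4 : ∫ x, f x * (b⁻¹ * k x) ∂π = b⁻¹ * ∫ x, f x * k x ∂π := by
    rw [← integral_const_mul]
    congr 1 with x
    ring
  rw [dirichletForm_const_mul, h4] at h3
  refine le_trans ?_ (mul_le_mul_right h3 (ENNReal.ofReal b))
  rw [ENNReal.mul_sub fun _ _ ↦ ENNReal.ofReal_ne_top, ← ENNReal.ofReal_mul hb0.le, ← mul_assoc (ENNReal.ofReal b),
    ← ENNReal.ofReal_mul hb0.le, hQ.integral_mul_weightedMean hf2 h2, ← hk]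
  have e1 : b * (2 * (b⁻¹ * ∫ x, f x * k x ∂π)) = 2 * ∫ x, f x * k x ∂π := by
    field_simp
  have e2 : ENNReal.ofReal (b * b⁻¹ ^ 2) = (ENNReal.ofReal b)⁻¹ := by
    rw [← ENNReal.ofReal_inv_of_pos hb0]
    congr 1
    field_simp
  rw [e1, e2]
  exact tsub_le_tsub_left (hm.le_dirichletForm_pseudo hQ hr hb1 hb hh) _

end Comparison

/-! ### Finiteness of the dual form under a spectral gap. -/

section Gap

variable {E : Type*} [MeasurableSpace E] {μ : Measure E} [IsProbabilityMeasure μ] {K : Kernel E E}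

theorem mul_evariance_le_dirichletForm {h : E → ℝ} (hh : Measurable h) (h2 : MemLp h 2 μ) :
    spectralGap μ K * evariance h μ ≤ dirichletForm μ K h := by
  rcases eq_or_ne (evariance h μ) 0 with h0 | h0
  · simp [h0]
  · refine (ENNReal.le_div_iff_mul_le (Or.inl h0) (Or.inl h2.evariance_ne_top)).1 ?_
    exact iInf_le_of_le h <| iInf_le_of_le hh <| iInf_le_of_le h2 <|
      iInf_le_of_le (pos_iff_ne_zero.2 h0) le_rfl

/-- For centred `F`, Young's inequality gives `2 ⟪F, h⟫ ≤ γ⁻¹ ‖F‖² + γ var h`, and the gap bounds `γ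
var h` by the Dirichlet form. A real `γ` below the gap is taken because the gap may be `∞`. -/
theorem dualForm_ne_top_of_spectralGap_pos (hgap : 0 < spectralGap μ K) {f : E → ℝ}
    (hf2 : MemLp f 2 μ) : dualForm μ K (fun x ↦ f x - ∫ y, f y ∂μ) ≠ ∞ := by
  obtain ⟨γ, hγ0, hγ⟩ : ∃ γ : ℝ, 0 < γ ∧ ENNReal.ofReal γ ≤ spectralGap μ K := by
    obtain ⟨c, hc0, hc⟩ := ENNReal.lt_iff_exists_nnreal_btwn.1 hgap
    exact ⟨c, by exact_mod_cast hc0, by rw [ENNReal.ofReal_coe_nnreal]; exact hc.le⟩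
  have hF2 := memLp_sub_integral hf2
  set F := fun x ↦ f x - ∫ y, f y ∂μ with hF
  have hF0 : ∫ x, F x ∂μ = 0 := by
    rw [hF, integral_sub (hf2.integrable one_le_two) (integrable_const _)]
    simp
  refine ne_top_of_le_ne_top (b := ENNReal.ofReal (γ⁻¹ * ∫ x, F x ^ 2 ∂μ)) ENNReal.ofReal_ne_top ?_
  refine iSup_le fun h ↦ iSup_le fun hh ↦ iSup_le fun h2 ↦ ?_
  rw [tsub_le_iff_right]
  have hH2 := memLp_sub_integral h2
  have h3 : ENNReal.ofReal (γ * ∫ x, (h x - ∫ y, h y ∂μ) ^ 2 ∂μ) ≤ dirichletForm μ K h := by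
    rw [ENNReal.ofReal_mul hγ0.le, ofReal_integral_eq_lintegral_ofReal hH2.integrable_sq
      (Eventually.of_forall fun x ↦ sq_nonneg _), ← evariance_eq_lintegral_ofReal]
    exact (mul_le_mul_left hγ _).trans (mul_evariance_le_dirichletForm hh h2)
  refine le_trans ?_ (add_le_add_right h3 _)
  rw [← ENNReal.ofReal_add (by positivity) (by positivity)]
  refine ENNReal.ofReal_le_ofReal ?_
  have h4 : ∫ x, F x * h x ∂μ = ∫ x, F x * (h x - ∫ y, h y ∂μ) ∂μ := by
    simp only [mul_sub]
    have h5 : Integrable (fun x ↦ F x * h x) μ := hF2.integrable_mul h2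
    rw [integral_sub h5 ((hF2.integrable one_le_two).mul_const _), integral_mul_const, hF0]
    simp
  have h6 : Integrable (fun x ↦ F x * (h x - ∫ y, h y ∂μ)) μ := hF2.integrable_mul hH2
  rw [h4, ← integral_const_mul, ← integral_const_mul, ← integral_const_mul,
    ← integral_add (hF2.integrable_sq.const_mul _) (hH2.integrable_sq.const_mul _)]
  refine integral_mono (h6.const_mul _)
    ((hF2.integrable_sq.const_mul _).add (hH2.integrable_sq.const_mul _)) fun x ↦ ?_
  have h7 : 0 ≤ γ⁻¹ * (F x - γ * (h x - ∫ y, h y ∂μ)) ^ 2 := by positivity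
  have h8 : γ⁻¹ * (F x - γ * (h x - ∫ y, h y ∂μ)) ^ 2 = γ⁻¹ * F x ^ 2 -
      2 * (F x * (h x - ∫ y, h y ∂μ)) + γ * (h x - ∫ y, h y ∂μ) ^ 2 := by
    field_simp
    ring
  linarith

end Gap

/-! ### Bounds on the asymptotic variance. -/

section AsymptoticVariance

variable {X : Type*} [MeasurableSpace X] {W : Set ℝ≥0}
  {π : Measure X} [IsProbabilityMeasure π] {q : Kernel X X} [IsMarkovKernel q]
  {r : X → X → ℝ≥0∞} {g : X → ℝ}

theorem tendsto_scaledVar_mhKernel (hr : Measurable (Function.uncurry r))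
    (hrπ : IsAcceptanceRatio π q r) (hgap : 0 < spectralGap π (mhKernel q r hr))
    (hg2 : MemLp g 2 π) :
    Tendsto (scaledVar π (mhKernel q r hr) g) atTop (𝓝 (asympVar π (mhKernel q r hr) g)) := by
  obtain ⟨m, a, _, hm⟩ := exists_isSymmDensity (π ⊗ₘ q) hrπ
  have hrev := hm.map_swap_mhKernel hr
  have hfin := dualForm_ne_top_of_spectralGap_pos hgap hg2
  rw [asympVar_eq hrev hg2 hfin]
  exact tendsto_scaledVar hrev hg2 hfin

theorem two_mul_ofReal_mul_sub_le {b : ℝ} (hb : 1 ≤ b) (s v : ℝ≥0∞) :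
    2 * (ENNReal.ofReal b * s) - v ≤
      ENNReal.ofReal b * (2 * s - v) + ENNReal.ofReal (b - 1) * v := by
  rw [tsub_le_iff_right, add_assoc]
  have h : ENNReal.ofReal (b - 1) * v + v = ENNReal.ofReal b * v := by
    rw [← add_one_mul, ← ENNReal.ofReal_one, ← ENNReal.ofReal_add (by linarith) zero_le_one,
      sub_add_cancel]
  rw [h, ← mul_add, mul_left_comm]
  gcongr
  exact le_tsub_add

/-- Existence of the asymptotic variance of the pseudo-marginal chain and its comparison with that
of the marginal chain. -/
theorem asympVar_pseudoKernel_bounds (hr : Measurable (Function.uncurry r))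
    (hrπ : IsAcceptanceRatio π q r) (hgap : 0 < spectralGap π (mhKernel q r hr))
    (hg : Measurable g) (hg2 : MemLp g 2 π) (Q : Kernel X W) [IsMarkovKernel Q]
    (hQ : HasMeanOne Q) {b : ℝ} (hb1 : 1 ≤ b) (hb : WeightsBoundedBy π Q b) :
    Tendsto (scaledVar (pseudoTarget π Q) (pseudoKernel q r hr Q) (fun z ↦ g z.1)) atTop
        (𝓝 (asympVar (pseudoTarget π Q) (pseudoKernel q r hr Q) (fun z ↦ g z.1))) ∧
      asympVar π (mhKernel q r hr) g ≤
        asympVar (pseudoTarget π Q) (pseudoKernel q r hr Q) (fun z ↦ g z.1) ∧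
      asympVar (pseudoTarget π Q) (pseudoKernel q r hr Q) (fun z ↦ g z.1) ≤
        ENNReal.ofReal b * asympVar π (mhKernel q r hr) g +
          ENNReal.ofReal (b - 1) * evariance g π := by
  obtain ⟨m, a, _, hm⟩ := exists_isSymmDensity (π ⊗ₘ q) hrπ
  have := hQ.isProbabilityMeasure (π := π)
  have hfst : MeasurePreserving Prod.fst (pseudoTarget π Q) π := hQ.measurePreserving_fst
  have hint : ∫ z, g z.1 ∂(pseudoTarget π Q) = ∫ x, g x ∂π := by
    have h3 := integral_map (μ := pseudoTarget π Q) measurable_fst.aemeasurable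
      hg.aestronglyMeasurable
    rw [hfst.map_eq] at h3
    exact h3.symm
  have hvar : evariance (fun z : X × W ↦ g z.1) (pseudoTarget π Q) = evariance g π := by
    rw [evariance_eq_lintegral_ofReal, evariance_eq_lintegral_ofReal, hint]
    exact hfst.lintegral_comp (f := fun x ↦ ENNReal.ofReal ((g x - ∫ y, g y ∂π) ^ 2)) (by fun_prop)
  have hfin := dualForm_ne_top_of_spectralGap_pos hgap hg2
  have hg2' : MemLp (fun z : X × W ↦ g z.1) 2 (pseudoTarget π Q) :=
    hg2.comp_measurePreserving hfst
  have hlow := hm.dualForm_le_dualForm_pseudo (f := fun x ↦ g x - ∫ y, g y ∂π) hQ hr (by fun_prop)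
  have hupp := hm.dualForm_pseudo_le hQ hr hb1 hb (memLp_sub_integral hg2)
  have hfin' : dualForm (pseudoTarget π Q) (pseudoKernel q r hr Q)
      (fun z ↦ g z.1 - ∫ z, g z.1 ∂(pseudoTarget π Q)) ≠ ∞ := by
    rw [hint]
    exact ne_top_of_le_ne_top (ENNReal.mul_ne_top ENNReal.ofReal_ne_top hfin) hupp
  have hrev := hm.map_swap_mhKernel hr
  have hrev' := hm.map_swap_pseudoKernel hQ hr
  have hlim := tendsto_scaledVar hrev' hg2' hfin'
  rw [asympVar_eq hrev hg2 hfin, asympVar_eq hrev' hg2' hfin']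
  refine ⟨hlim, ?_, ?_⟩
  · rw [hvar, hint]
    gcongr
  · rw [hvar, hint]
    refine le_trans ?_ (two_mul_ofReal_mul_sub_le hb1 _ _)
    gcongr

end AsymptoticVariance

end PseudoMarginal

theorem mainTheorem7 {X : Type*} [MeasurableSpace X]
    (π : Measure X) [IsProbabilityMeasure π]
    (q : Kernel X X) [IsMarkovKernel q]
    (r : X → X → ℝ≥0∞) (hr : Measurable (Function.uncurry r))
    (hrπ : PseudoMarginal.IsAcceptanceRatio π q r)
    (hgap : 0 < PseudoMarginal.spectralGap π (PseudoMarginal.mhKernel q r hr))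
    (g : X → ℝ) (hg : Measurable g) (hg2 : MemLp g 2 π) :
    -- the limit that defines `var (g, P)` exists
    Tendsto (PseudoMarginal.scaledVar π (PseudoMarginal.mhKernel q r hr) g) atTop
      (𝓝 (PseudoMarginal.asympVar π (PseudoMarginal.mhKernel q r hr) g)) ∧
    -- existence of the limit that defines `var (g, P̃)`, and the two bounds
    (∀ (W : Set ℝ≥0), MeasurableSet W →
      ∀ (Q : Kernel X W) [IsMarkovKernel Q], PseudoMarginal.HasMeanOne Q →
      ∀ b : ℝ, 1 ≤ b → PseudoMarginal.WeightsBoundedBy π Q b →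
        Tendsto
          (PseudoMarginal.scaledVar (PseudoMarginal.pseudoTarget π Q)
            (PseudoMarginal.pseudoKernel q r hr Q) (fun z ↦ g z.1)) atTop
          (𝓝 (PseudoMarginal.asympVar (PseudoMarginal.pseudoTarget π Q)
            (PseudoMarginal.pseudoKernel q r hr Q) (fun z ↦ g z.1))) ∧
        PseudoMarginal.asympVar π (PseudoMarginal.mhKernel q r hr) g ≤
          PseudoMarginal.asympVar (PseudoMarginal.pseudoTarget π Q)
            (PseudoMarginal.pseudoKernel q r hr Q) (fun z ↦ g z.1) ∧
        PseudoMarginal.asympVar (PseudoMarginal.pseudoTarget π Q)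
            (PseudoMarginal.pseudoKernel q r hr Q) (fun z ↦ g z.1) ≤
          ENNReal.ofReal b * PseudoMarginal.asympVar π (PseudoMarginal.mhKernel q r hr) g +
            ENNReal.ofReal (b - 1) * evariance g π) ∧
    -- convergence to the marginal asymptotic variance as the bound on the weights tends to one
    (∀ (W : ℕ → Set ℝ≥0), (∀ N, MeasurableSet (W N)) →
      ∀ (Q : ∀ N, Kernel X (W N)) [∀ N, IsMarkovKernel (Q N)],
      (∀ N, PseudoMarginal.HasMeanOne (Q N)) →
      ∀ b : ℕ → ℝ, Tendsto b atTop (𝓝 1) →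
      (∀ᶠ N in atTop, 1 ≤ b N ∧ PseudoMarginal.WeightsBoundedBy π (Q N) (b N)) →
        Tendsto
          (fun N ↦ PseudoMarginal.asympVar (PseudoMarginal.pseudoTarget π (Q N))
            (PseudoMarginal.pseudoKernel q r hr (Q N)) (fun z ↦ g z.1)) atTop
          (𝓝 (PseudoMarginal.asympVar π (PseudoMarginal.mhKernel q r hr) g))) := by
  refine ⟨PseudoMarginal.tendsto_scaledVar_mhKernel hr hrπ hgap hg2, ?_, ?_⟩
  · intro W _ Q _ hQ b hb1 hb
    exact PseudoMarginal.asympVar_pseudoKernel_bounds hr hrπ hgap hg hg2 Q hQ hb1 hb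
  · intro W _ Q _ hQ b hb hbd
    have hev : evariance g π ≠ ∞ := hg2.evariance_ne_top
    have h1 : Tendsto (fun N ↦ ENNReal.ofReal (b N) *
        PseudoMarginal.asympVar π (PseudoMarginal.mhKernel q r hr) g +
          ENNReal.ofReal (b N - 1) * evariance g π) atTop
        (𝓝 (ENNReal.ofReal 1 * PseudoMarginal.asympVar π (PseudoMarginal.mhKernel q r hr) g +
          ENNReal.ofReal (1 - 1) * evariance g π)) :=
      -- Multiplication in `ℝ≥0∞` is continuous here because the limit `1` of the first factor is
      -- nonzero; in the second product the factor tends to `0`, so finiteness of the variance is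
      -- needed.
      (ENNReal.Tendsto.mul_const (ENNReal.tendsto_ofReal hb) (Or.inl (by simp))).add
        (ENNReal.Tendsto.mul_const (ENNReal.tendsto_ofReal (hb.sub_const 1)) (Or.inr hev))
    simp only [ENNReal.ofReal_one, one_mul, sub_self, ENNReal.ofReal_zero, zero_mul,
      add_zero] at h1
    refine tendsto_of_tendsto_of_tendsto_of_le_of_le' tendsto_const_nhds h1 ?_ ?_
    · filter_upwards [hbd] with N hN
      exact (PseudoMarginal.asympVar_pseudoKernel_bounds hr hrπ hgap hg hg2 (Q N) (hQ N)
        hN.1 hN.2).2.1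
    · filter_upwards [hbd] with N hN
      exact (PseudoMarginal.asympVar_pseudoKernel_bounds hr hrπ hgap hg hg2 (Q N) (hQ N)
        hN.1 hN.2).2.2
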